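/- Let $n\ge 5$. Let $\Delta=|\Lambda(\mathbb F_2^{n-1})|$ be the spherical building associated to $\mathbb F_2^{n-1}$: its vertices are the linear subspaces $U$ of $\mathbb F_2^{n-1}$ with $0\neq U\neq\mathbb F_2^{n-1}$, and its simplices are the finite non-empty chains of such subspaces under inclusion. Equip $\Delta$ with its natural spherical metric: apply to each closed simplex the rank-preserving identification with a face of a chamber of the Coxeter complex of $S_{n-1}$ (the unit sphere of $\{x\in\mathbb R^{n-1}:\sum_k x_k=0\}$, triangulated by the hyperplanes $x_k=x_l$), give the simplex the angular metric of that sphere, and let $\Delta$ carry the induced length metric. Let $e_1,\dots,e_{n-1}$ be the standard basis of $\mathbb F_2^{n-1}$ and put $e_n=0$. Let $\mathrm{NCP}_n$ be the set of non-crossing partitions of $\{1,\dots,n\}$, that is, of the partitions for which there are no $a<b<c<d$ with $a,c$ in one block and $b,d$ in a different block. Identify $\pi\in\mathrm{NCP}_n$ with the subspace of $\mathbb F_2^{n-1}$ spanned by all $e_i+e_j$ such that $i<j$ lie in a common block of $\pi$. Let $|\mathrm{NCP}_n|\subseteq\Delta$ be the subcomplex consisting of all simplices whose vertices are all non-crossing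 partitions. **Theorem.** Let $p$ be a vertex of $\Delta$ that is not contained in $|\mathrm{NCP}_n|$. Then there exists a geodesic $\gamma\colon[0,\pi]\to\Delta$ (an isometry onto its image, so of length $\pi$) with $p\in\gamma$ and $\gamma\cap|\mathrm{NCP}_n|=\emptyset$. Moreover, $\gamma$ can be chosen as the concatenation of three edges of $\Delta$, from a vertex $p_u$ to $p$, from $p$ to a vertex $q$, and from $q$ to a vertex $p_v$. -/

import Mathlib

noncomputable section

/-! ## The spherical building of linear subspaces of `𝔽₂ⁿ⁻¹` as a simplicial complex -/

/-- The vector space `𝔽₂ⁿ⁻¹`. -/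
abbrev FTwoSpace (n : ℕ) : Type := Fin (n - 1) → ZMod 2

/-- The vertices of the building `Δ`: the elements of the lattice of linear subspaces of `𝔽₂ⁿ⁻¹`
other than its minimum and its maximum, ordered by inclusion. -/
abbrev BuildingVertex (n : ℕ) : Type :=
  {U : Submodule (ZMod 2) (FTwoSpace n) // U ≠ ⊥ ∧ U ≠ ⊤}

/-- The rank of a vertex is the dimension of the subspace. -/
def BuildingVertex.rank {n : ℕ} (U : BuildingVertex n) : ℕ :=
  Module.finrank (ZMod 2) U.1

/-- The building `Δ = |Λ(𝔽₂ⁿ⁻¹)|`: the order complex of the lattice of linear subspaces. The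
simplices are the non-empty finite chains of proper non-zero subspaces. -/
def buildingComplex (n : ℕ) : AbstractSimplicialComplex (BuildingVertex n) where
  faces := {σ | σ.Nonempty ∧ IsChain (· ≤ ·) (σ : Set (BuildingVertex n))}
  isRelLowerSet_faces := fun _ hσ =>
    ⟨hσ.1, fun _ hτσ hτ => ⟨hτ, hσ.2.mono (Finset.coe_subset.mpr hτσ)⟩⟩
  singleton_mem := fun v => ⟨Finset.singleton_nonempty v, by simp⟩

/-- Two vertices of `Δ` are joined by an edge of `Δ`. -/
def BuildingVertex.Adjacent {n : ℕ} (U U' : BuildingVertex n) : Prop := U < U' ∨ U' < U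

/-! ## Non-crossing partitions and their embedding -/

/-- A partition of `{1, …, n}`, given as an equivalence relation on `Fin n` whose classes are the
blocks, is non-crossing if there are no `a < b < c < d` such that `a, c` lie in one block and
`b, d` lie in a different block. -/
def IsNonCrossing {n : ℕ} (P : Setoid (Fin n)) : Prop :=
  ¬ ∃ a b c d : Fin n, a < b ∧ b < c ∧ c < d ∧ P a c ∧ P b d ∧ ¬ P a b

/-- The standard basis vectors `e₁, …, eₙ₋₁` of `𝔽₂ⁿ⁻¹`, supplemented by `eₙ = 0`
(the label `k` of the `n`-gon is the element `k - 1` of `Fin n`). -/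
def edgeBasisVector (n : ℕ) (i : Fin n) : FTwoSpace n :=
  fun k => if (k : ℕ) = (i : ℕ) then 1 else 0

/-- The rank one subspace of an edge `(i, j)` of the `n`-gon, `i < j`: it is `⟨eᵢ + eⱼ⟩` if
`j < n`, and `⟨eᵢ⟩` if `j = n`. -/
def edgeSubspace (n : ℕ) (i j : Fin n) : Submodule (ZMod 2) (FTwoSpace n) :=
  Submodule.span (ZMod 2) {edgeBasisVector n i + edgeBasisVector n j}

/-- The embedding of the partition lattice into the lattice of linear subspaces: a partition is
mapped to the join of the subspaces of its edges. By `iSup_edgeSubspace_eq` below it is enough to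
take the edges of an arbitrary spanning forest of the partition. -/
def partitionSubspace {n : ℕ} (P : Setoid (Fin n)) : Submodule (ZMod 2) (FTwoSpace n) :=
  ⨆ (i : Fin n) (j : Fin n) (_ : i < j ∧ P i j), edgeSubspace n i j

theorem FTwoSpace.add_self {n : ℕ} (v : FTwoSpace n) : v + v = 0 := by
  funext k
  exact CharTwo.add_self_eq_zero (v k)

theorem edgeSubspace_comm {n : ℕ} (i j : Fin n) : edgeSubspace n i j = edgeSubspace n j i := by
  unfold edgeSubspace
  rw [add_comm]

theorem edgeSubspace_self {n : ℕ} (i : Fin n) : edgeSubspace n i i = ⊥ := by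
  unfold edgeSubspace
  rw [FTwoSpace.add_self, Submodule.span_zero_singleton]

theorem edgeSubspace_le_sup {n : ℕ} (i j k : Fin n) :
    edgeSubspace n i k ≤ edgeSubspace n i j ⊔ edgeSubspace n j k := by
  unfold edgeSubspace
  rw [Submodule.span_singleton_le_iff_mem]
  have h : edgeBasisVector n i + edgeBasisVector n k
      = (edgeBasisVector n i + edgeBasisVector n j)
        + (edgeBasisVector n j + edgeBasisVector n k) := by
    have := FTwoSpace.add_self (edgeBasisVector n j)
    calc edgeBasisVector n i + edgeBasisVector n k
        = edgeBasisVector n i + 0 + edgeBasisVector n k := by rw [add_zero]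
      _ = _ := by rw [← this]; abel
  rw [h]
  exact Submodule.add_mem_sup (Submodule.mem_span_singleton_self _)
    (Submodule.mem_span_singleton_self _)

/-- If a set `A` of edges generates the partition `P`, that is, if the blocks of `P` are the
connected components of the graph with edge set `A`, then the image of `P` is the join of the
subspaces of the edges in `A`. -/
theorem iSup_edgeSubspace_eq {n : ℕ} (A : Set (Fin n × Fin n)) :
    ⨆ a ∈ A, edgeSubspace n a.1 a.2
      = partitionSubspace (Relation.EqvGen.setoid fun i j => (i, j) ∈ A) := by
  apply le_antisymm
  · refine iSup₂_le fun a ha => ?_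
    have hP : (Relation.EqvGen.setoid fun i j => (i, j) ∈ A) a.1 a.2 :=
      Relation.EqvGen.rel _ _ ha
    rcases lt_trichotomy a.1 a.2 with h | h | h
    · exact le_iSup_of_le a.1 (le_iSup_of_le a.2 (le_iSup_of_le ⟨h, hP⟩ le_rfl))
    · rw [h, edgeSubspace_self]
      exact bot_le
    · rw [edgeSubspace_comm]
      exact le_iSup_of_le a.2 (le_iSup_of_le a.1
        (le_iSup_of_le ⟨h, Relation.EqvGen.symm _ _ hP⟩ le_rfl))
  · refine iSup_le fun i => iSup_le fun j => iSup_le fun h => ?_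
    have h2 : Relation.EqvGen (fun i j => (i, j) ∈ A) i j := h.2
    clear h
    induction h2 with
    | rel x y hxy => exact le_iSup₂_of_le (x, y) hxy le_rfl
    | refl x => rw [edgeSubspace_self]; exact bot_le
    | symm x y _ ih => rw [edgeSubspace_comm]; exact ih
    | trans x y z _ _ ih1 ih2 => exact (edgeSubspace_le_sup x y z).trans (sup_le ih1 ih2)

/-- A vertex of `Δ` is a non-crossing partition if it is the image of one. -/
def BuildingVertex.IsNCP {n : ℕ} (U : BuildingVertex n) : Prop :=
  ∃ P : Setoid (Fin n), IsNonCrossing P ∧ partitionSubspace P = U.1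

/-- The non-crossing partition complex `|NCPₙ|` as the induced subcomplex of the building `Δ`
spanned by the vertices that are non-crossing partitions. -/
def ncpComplex (n : ℕ) : PreAbstractSimplicialComplex (BuildingVertex n) where
  faces := {σ | σ ∈ (buildingComplex n).faces ∧ ∀ U ∈ σ, U.IsNCP}
  isRelLowerSet_faces := fun _ hσ =>
    ⟨hσ.1.1, fun _ hτσ hτ =>
      ⟨((buildingComplex n).isRelLowerSet_faces hσ.1).2 hτσ hτ, fun U hU => hσ.2 U (hτσ hU)⟩⟩

/-! ## The spherical realization of the building and its length metric -/

/-- The points of the realization of `Δ`, in barycentric coordinates: functions with non-negative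
values, whose support is a simplex, and whose values add up to `1`. -/
structure Building (n : ℕ) where
  weight : BuildingVertex n →₀ ℝ
  weight_nonneg : ∀ U, 0 ≤ weight U
  support_mem : weight.support ∈ (buildingComplex n).faces
  sum_weight : (weight.sum fun _ c => c) = 1

namespace Building

variable {n : ℕ}

/-- A vertex, as a point of the realization. -/
def ofVertex (U : BuildingVertex n) : Building n where
  weight := Finsupp.single U 1
  weight_nonneg := fun U' => by
    classical
    rw [Finsupp.single_apply]
    split_ifs <;> norm_num
  support_mem := by
    rw [Finsupp.support_single U one_ne_zero]
    exact (buildingComplex n).singleton_mem U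
  sum_weight := by simp

/-- The closed edge spanned by two adjacent vertices. -/
def edge (U U' : BuildingVertex n) : Set (Building n) :=
  {x | ∀ V ∈ x.weight.support, V = U ∨ V = U'}

/-- The points of the realization of the non-crossing partition complex. -/
def ncp (n : ℕ) : Set (Building n) := {x | x.weight.support ∈ (ncpComplex n).faces}

/-- The vector on the ray of the rank `i` vertex of the fundamental chamber
`x₁ ≥ x₂ ≥ ⋯ ≥ xₙ₋₁` of the Coxeter group `Sₙ₋₁`, which acts by permutation of the coordinates on
the Euclidean space of vectors in `ℝⁿ⁻¹` with coordinate sum zero: the orthogonal projection of the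
indicator vector of the first `i` coordinates. -/
def chamberVector (n i : ℕ) : EuclideanSpace ℝ (Fin (n - 1)) :=
  WithLp.toLp 2 fun k => (if (k : ℕ) < i then 1 else 0) - (i : ℝ) / ((n - 1 : ℕ) : ℝ)

/-- The chart that maps every closed simplex of `Δ` to the corresponding face of the fundamental
chamber of the Coxeter complex, by preserving the ranks of the vertices; the point of the unit
sphere is the one on the ray through this vector. -/
def chart (x : Building n) : EuclideanSpace ℝ (Fin (n - 1)) :=
  x.weight.sum fun U c => c • chamberVector n U.rank

/-- Two points lie in a common closed simplex. -/
def InCommonSimplex (x y : Building n) : Prop :=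
  ∃ σ ∈ (buildingComplex n).faces, x.weight.support ⊆ σ ∧ y.weight.support ⊆ σ

/-- The spherical distance of two points of a common closed simplex. -/
def simplexDist (x y : Building n) : ℝ := InnerProductGeometry.angle (chart x) (chart y)

/-- There is a broken path `x = x₀, x₁, …, xₘ = y` of length `l`, in which any two consecutive
points lie in a common closed simplex and are joined by the spherical segment in it. -/
inductive HasBrokenPath : Building n → Building n → ENNReal → Prop
  | refl (x : Building n) : HasBrokenPath x x 0
  | step {x y z : Building n} {l : ENNReal} (hxy : InCommonSimplex x y)
      (hyz : HasBrokenPath y z l) : HasBrokenPath x z (ENNReal.ofReal (simplexDist x y) + l)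

theorem InCommonSimplex.symm {x y : Building n} (h : InCommonSimplex x y) :
    InCommonSimplex y x := by
  obtain ⟨σ, hσ, hx, hy⟩ := h
  exact ⟨σ, hσ, hy, hx⟩

theorem HasBrokenPath.trans {x y z : Building n} {l m : ENNReal} (h : HasBrokenPath x y l)
    (h' : HasBrokenPath y z m) : HasBrokenPath x z (l + m) := by
  induction h with
  | refl x => rwa [zero_add]
  | step hxy _ ih => rw [add_assoc]; exact HasBrokenPath.step hxy (ih h')

theorem HasBrokenPath.symm {x y : Building n} {l : ENNReal} (h : HasBrokenPath x y l) :
    HasBrokenPath y x l := by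
  induction h with
  | refl x => exact HasBrokenPath.refl x
  | @step x y z l hxy _ ih =>
    have h1 : HasBrokenPath y x (ENNReal.ofReal (simplexDist x y) + 0) := by
      have h2 : simplexDist x y = simplexDist y x := InnerProductGeometry.angle_comm _ _
      rw [h2]
      exact HasBrokenPath.step hxy.symm (HasBrokenPath.refl x)
    rw [add_zero] at h1
    rw [add_comm]
    exact ih.trans h1

/-- The length metric induced by the spherical metrics on the simplices: the infimum of the lengths
of the broken paths joining two points. -/
instance : EDist (Building n) := ⟨fun x y => sInf {l | HasBrokenPath x y l}⟩

instance : PseudoEMetricSpace (Building n) where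
  edist_self := fun x => le_antisymm (sInf_le (HasBrokenPath.refl x)) bot_le
  edist_comm := fun x y => by
    apply le_antisymm
    · exact le_sInf fun l hl => sInf_le (HasBrokenPath.symm hl)
    · exact le_sInf fun l hl => sInf_le (HasBrokenPath.symm hl)
  edist_triangle := fun x y z => by
    refine le_of_forall_gt fun c hc => ?_
    obtain ⟨a, ha, b, hb, hab⟩ : ∃ a, HasBrokenPath x y a ∧ ∃ b, HasBrokenPath y z b ∧ a + b < c := by
      change sInf {l | HasBrokenPath x y l} + sInf {l | HasBrokenPath y z l} < c at hc
      rw [ENNReal.sInf_add] at hc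
      simp only [iInf_lt_iff] at hc
      obtain ⟨a, ha, hc⟩ := hc
      rw [add_comm, ENNReal.sInf_add] at hc
      simp only [iInf_lt_iff] at hc
      obtain ⟨b, hb, hc⟩ := hc
      exact ⟨a, ha, b, hb, by rwa [add_comm]⟩
    exact lt_of_le_of_lt (sInf_le (ha.trans hb)) hab

/-- A geodesic of length `l`: an isometry on the interval `[0, l]`. -/
def IsGeodesic (γ : ℝ → Building n) (l : ℝ) : Prop :=
  Isometry ((Set.Icc 0 l).domRestrict γ)

end Building

end

noncomputable section

/-! ## Labels, edge vectors and crossing functionals -/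

/-! Two kinds of vertices certainly lie outside the non-crossing partition complex: a line spanned
by a nonzero `x` that is not of the form `eᵢ + eⱼ`, and a hyperplane `ker g` with `g` constant on
`{a, c}` and on `{b, d}` but with different values, `a < b < c < d`. If `g x = 1`, the line `L` and
the hyperplane `H = ker g` are complementary, hence opposite in the building. For `p` containing
`x`, the vertices `L`, `p`, `p ⊓ H`, `H` lie on a half great circle; for `p ≤ H`, so do `H`, `p`, `p
⊔ L`, `L`. A point of an edge can lie in the full subcomplex only if an endpoint does, so it
suffices to choose `x` and `g` such that the fourth vertex is proper and is no non-crossing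
partition either.

This choice (`hasOppositePair_of_not_isNCPSubspace`) depends on why `p` fails. If `p` is not spanned
by its edge vectors, a functional `f` kills these but not some `y` in `p`, and the fourth vertex is
made to fail for the same kind of reason. If `p` comes from a crossing partition, the fourth vertex
keeps the crossing edges `ac`, `bd` and still avoids `ab`. The bound `5 ≤ n` supplies a fifth label
throughout.

For the metric part, the spherical distance from `L` is computed simplex by simplex as the angle
`lineAngle x` to a fixed point of the model sphere. It is 1-Lipschitz for the length metric, which
bounds distances below. Along each of the three edges it grows exactly by the length travelled, from
`0` to `π`. Its inverse on their union is therefore the required geodesic. -/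

/-- The functional on `𝔽₂ⁿ⁻¹` whose values on the vectors `eᵢ + eⱼ` are the sums `S i + S j`. -/
def labelFunctional {n : ℕ} (S : Fin n → ZMod 2) : FTwoSpace n →ₗ[ZMod 2] ZMod 2 :=
  ∑ k : Fin (n - 1), (S (k.castLE (Nat.sub_le n 1)) + S ⟨n - 1, by have := k.2; omega⟩) • LinearMap.proj k

theorem labelFunctional_add {n : ℕ} (S T : Fin n → ZMod 2) :
    labelFunctional (S + T) = labelFunctional S + labelFunctional T := by
  unfold labelFunctional
  rw [← Finset.sum_add_distrib]
  refine Finset.sum_congr rfl fun k _ => ?_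
  rw [← add_smul]
  congr 1
  simp only [Pi.add_apply]
  ring

theorem labelFunctional_edgeBasisVector {n : ℕ} (S : Fin n → ZMod 2) (i : Fin n) :
    labelFunctional S (edgeBasisVector n i) = S i + S ⟨n - 1, by have := i.2; omega⟩ := by
  have hsum : labelFunctional S (edgeBasisVector n i) = ∑ k : Fin (n - 1),
      (S (k.castLE (Nat.sub_le n 1)) + S ⟨n - 1, by have := i.2; omega⟩) * (if (k : ℕ) = (i : ℕ) then 1 else 0) := by
    simp [labelFunctional, edgeBasisVector]
  rw [hsum]
  by_cases hi : (i : ℕ) < n - 1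
  · rw [Finset.sum_eq_single ⟨i, hi⟩]
    · simp [Fin.castLE]
    · intro k _ hk
      rw [if_neg fun h => hk (Fin.ext h), mul_zero]
    · simp
  · have hlast : i = ⟨n - 1, by omega⟩ := Fin.ext (by simp only []; omega)
    rw [Finset.sum_eq_zero, hlast, CharTwo.add_self_eq_zero]
    intro k _
    rw [if_neg (by omega), mul_zero]

theorem labelFunctional_edge {n : ℕ} (S : Fin n → ZMod 2) (i j : Fin n) :
    labelFunctional S (edgeBasisVector n i + edgeBasisVector n j) = S i + S j := by
  rw [map_add, labelFunctional_edgeBasisVector, labelFunctional_edgeBasisVector]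
  have := CharTwo.add_self_eq_zero (S ⟨n - 1, by have := i.2; omega⟩)
  linear_combination this

theorem ZMod.eq_one_of_ne_zero_two {x : ZMod 2} (h : x ≠ 0) : x = 1 := by
  revert x; decide

theorem ZMod.eq_of_add_eq_zero_two {x y : ZMod 2} (h : x + y = 0) : x = y :=
  CharTwo.add_eq_zero.mp h

/-- The vectors `eᵢ + eⱼ`, including zero. -/
def IsEdgeVector {n : ℕ} (v : FTwoSpace n) : Prop :=
  ∃ i j : Fin n, v = edgeBasisVector n i + edgeBasisVector n j

/-- A functional whose kernel is the subspace of a crossing partition into two blocks. -/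
def IsCrossingFunctional {n : ℕ} (g : FTwoSpace n →ₗ[ZMod 2] ZMod 2) : Prop :=
  ∃ a b c d : Fin n, a < b ∧ b < c ∧ c < d ∧
    g (edgeBasisVector n a) = g (edgeBasisVector n c) ∧
    g (edgeBasisVector n b) = g (edgeBasisVector n d) ∧
    g (edgeBasisVector n a) ≠ g (edgeBasisVector n b)

theorem isCrossingFunctional_labelFunctional {n : ℕ} {S : Fin n → ZMod 2} {a b c d : Fin n}
    (hab : a < b) (hbc : b < c) (hcd : c < d) (hac : S a = S c) (hbd : S b = S d)
    (h : S a ≠ S b) : IsCrossingFunctional (labelFunctional S) := by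
  refine ⟨a, b, c, d, hab, hbc, hcd, ?_, ?_, ?_⟩ <;>
    simp only [labelFunctional_edgeBasisVector, hac, hbd]
  rw [← hac, ← hbd]
  exact fun h' => h (add_right_cancel h')

/-- Identify `𝔽₂ⁿ⁻¹` with the even-weight vectors of `𝔽₂ⁿ`, sending `eᵢ + eⱼ` to the indicator of
`{i, j}`. The vector here has weight four and an edge vector has weight at most two. The functionals
`labelFunctional (Pi.single t 1)` read off the coordinates. -/
theorem not_isEdgeVector_of_ne {n : ℕ} {i j k l : Fin n} (hij : i ≠ j) (hik : i ≠ k) (hil : i ≠ l)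
    (hjk : j ≠ k) (hjl : j ≠ l) (hkl : k ≠ l) :
    ¬ IsEdgeVector (edgeBasisVector n i + edgeBasisVector n j
      + (edgeBasisVector n k + edgeBasisVector n l)) := by
  rintro ⟨r, s, h⟩
  have key : ∀ t, (t = i ∨ t = j ∨ t = k ∨ t = l) → r = t ∨ s = t := by
    intro t ht
    have h1 := congrArg (labelFunctional (Pi.single t 1)) h
    rw [map_add, labelFunctional_edge, labelFunctional_edge, labelFunctional_edge] at h1
    by_contra! hrs
    rw [Pi.single_eq_of_ne hrs.1, Pi.single_eq_of_ne hrs.2] at h1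
    rcases ht with rfl | rfl | rfl | rfl
    · simp [hij.symm, hik.symm, hil.symm] at h1
    · simp [hij, hjk.symm, hjl.symm] at h1
    · simp [hik, hjk, hkl.symm] at h1
    · simp [hil, hjl, hkl] at h1
  have := key i (by simp)
  have := key j (by simp)
  have := key k (by simp)
  have := key l (by simp)
  grind

/-! ### Edge vectors in the subspace of a partition -/

theorem edge_mem_partitionSubspace {n : ℕ} {P : Setoid (Fin n)} {i j : Fin n} (h : P i j) :
    edgeBasisVector n i + edgeBasisVector n j ∈ partitionSubspace P := by
  have key : ∀ i j : Fin n, i < j → P i j → edgeSubspace n i j ≤ partitionSubspace P :=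
    fun i j hij h => le_iSup_of_le i (le_iSup_of_le j (le_iSup_of_le ⟨hij, h⟩ le_rfl))
  have hmem := Submodule.mem_span_singleton_self (R := ZMod 2)
    (edgeBasisVector n i + edgeBasisVector n j)
  rcases lt_trichotomy i j with hij | rfl | hij
  · exact key i j hij h hmem
  · rw [FTwoSpace.add_self]
    exact Submodule.zero_mem _
  · refine key j i hij (P.symm h) ?_
    rw [edgeSubspace_comm]
    exact hmem

/-- A functional that vanishes on the edge vectors of a partition subspace vanishes on all of it. -/
theorem partitionSubspace_le_ker {n : ℕ} {P : Setoid (Fin n)} {f : FTwoSpace n →ₗ[ZMod 2] ZMod 2}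
    (hf : ∀ i j, edgeBasisVector n i + edgeBasisVector n j ∈ partitionSubspace P →
      f (edgeBasisVector n i + edgeBasisVector n j) = 0) :
    partitionSubspace P ≤ LinearMap.ker f := by
  refine iSup_le fun i => iSup_le fun j => iSup_le fun h => ?_
  unfold edgeSubspace
  rw [Submodule.span_singleton_le_iff_mem, LinearMap.mem_ker]
  exact hf i j (edge_mem_partitionSubspace h.2)

/-- The partition can be recovered from its subspace: the indicator of the block of `i` is constant
on every block, so its functional kills the subspace, but it takes the value one on `eᵢ + eⱼ` when
`j` lies outside the block. -/
theorem edge_mem_partitionSubspace_iff {n : ℕ} {P : Setoid (Fin n)} {i j : Fin n} :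
    edgeBasisVector n i + edgeBasisVector n j ∈ partitionSubspace P ↔ P i j := by
  classical
  refine ⟨fun h => ?_, edge_mem_partitionSubspace⟩
  let S : Fin n → ZMod 2 := fun k => if P i k then 1 else 0
  have hle : partitionSubspace P ≤ LinearMap.ker (labelFunctional S) := by
    refine iSup_le fun k => iSup_le fun l => iSup_le fun h => ?_
    unfold edgeSubspace
    rw [Submodule.span_singleton_le_iff_mem, LinearMap.mem_ker, labelFunctional_edge]
    have : P i k ↔ P i l := ⟨fun h' => P.trans h' h.2, fun h' => P.trans h' (P.symm h.2)⟩
    simp only [S, this]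
    exact CharTwo.add_self_eq_zero _
  have h1 := LinearMap.mem_ker.mp (hle h)
  rw [labelFunctional_edge] at h1
  by_contra hij
  simp [S, hij] at h1

/-- The only nonzero vector of the line is `x`, so the line contains no nonzero edge vector, whereas
a partition subspace is spanned by edge vectors. -/
theorem partitionSubspace_ne_span {n : ℕ} {x : FTwoSpace n} (hx : ¬ IsEdgeVector x)
    (hx0 : x ≠ 0) (P : Setoid (Fin n)) : partitionSubspace P ≠ Submodule.span (ZMod 2) {x} := by
  intro h
  obtain ⟨f, hf, -⟩ := Submodule.exists_le_ker_of_notMem (K := ZMod 2) (p := ⊥) (v := x)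
    (by simpa using hx0)
  refine hf (partitionSubspace_le_ker (P := P) (fun i j hij => ?_)
    (h ▸ Submodule.mem_span_singleton_self x))
  rw [h, Submodule.mem_span_singleton] at hij
  obtain ⟨c, hc⟩ := hij
  by_cases hc0 : c = 0
  · rw [← hc, hc0, zero_smul, map_zero]
  · rw [ZMod.eq_one_of_ne_zero_two hc0, one_smul] at hc
    exact (hx ⟨i, j, hc⟩).elim

/-- A non-crossing partition that contains the edges from `a` to `c` and from `b` to `d`, where
`a < b < c < d`, also contains the edge from `a` to `b`. -/
theorem IsNonCrossing.edge_mem {n : ℕ} {P : Setoid (Fin n)} (hP : IsNonCrossing P)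
    {a b c d : Fin n} (hab : a < b) (hbc : b < c) (hcd : c < d)
    (hac : edgeBasisVector n a + edgeBasisVector n c ∈ partitionSubspace P)
    (hbd : edgeBasisVector n b + edgeBasisVector n d ∈ partitionSubspace P) :
    edgeBasisVector n a + edgeBasisVector n b ∈ partitionSubspace P := by
  rw [edge_mem_partitionSubspace_iff] at *
  by_contra h
  exact hP ⟨a, b, c, d, hab, hbc, hcd, hac, hbd, h⟩

theorem IsNonCrossing.partitionSubspace_ne_ker {n : ℕ} {P : Setoid (Fin n)} (hP : IsNonCrossing P)
    {g : FTwoSpace n →ₗ[ZMod 2] ZMod 2} (hg : IsCrossingFunctional g) :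
    partitionSubspace P ≠ LinearMap.ker g := by
  obtain ⟨a, b, c, d, hab, hbc, hcd, hac, hbd, h⟩ := hg
  intro hPg
  have := hP.edge_mem hab hbc hcd
    (by rw [hPg, LinearMap.mem_ker, map_add, hac, CharTwo.add_self_eq_zero])
    (by rw [hPg, LinearMap.mem_ker, map_add, hbd, CharTwo.add_self_eq_zero])
  rw [hPg, LinearMap.mem_ker, map_add] at this
  exact h (ZMod.eq_of_add_eq_zero_two this)

/-! ### Abundance of crossing functionals and of non-edge vectors -/

theorem exists_labelFunctional_single_ne_zero {n : ℕ} {z : FTwoSpace n} (hz : z ≠ 0) :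
    ∃ i, labelFunctional (Pi.single i 1) z ≠ 0 := by
  obtain ⟨k, hk⟩ := Function.ne_iff.mp hz
  refine ⟨k.castLE (Nat.sub_le n 1), ?_⟩
  have : labelFunctional (Pi.single (k.castLE (Nat.sub_le n 1)) 1) z = z k := by
    simp only [labelFunctional, LinearMap.sum_apply, LinearMap.smul_apply, LinearMap.proj_apply]
    rw [Finset.sum_eq_single k]
    · have h2 : n - 1 ≠ (k : ℕ) := by omega
      simp [Fin.ext_iff, h2]
    · intro l _ hl
      have h1 : (l : ℕ) ≠ k := fun h => hl (Fin.ext h)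
      have h2 : n - 1 ≠ (k : ℕ) := by omega
      simp [Fin.ext_iff, h1, h2]
    · simp
  rw [this]
  exact hk

theorem isCrossingFunctional_pair {n : ℕ} {a b c d : Fin n} (hab : a < b) (hbc : b < c)
    (hcd : c < d) :
    IsCrossingFunctional (labelFunctional (Pi.single a 1 + Pi.single c 1)) ∧
      IsCrossingFunctional (labelFunctional (Pi.single b 1 + Pi.single d 1)) := by
  constructor <;> refine isCrossingFunctional_labelFunctional hab hbc hcd ?_ ?_ ?_ <;>
    simp [hab.ne, hab.ne', hbc.ne, hbc.ne', hcd.ne, hcd.ne', (hab.trans hbc).ne,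
      (hab.trans hbc).ne', (hbc.trans hcd).ne, (hbc.trans hcd).ne', (hab.trans (hbc.trans hcd)).ne,
      (hab.trans (hbc.trans hcd)).ne']

/-- Crossing functionals separate points from zero. If all of them vanished at `z`, the two-element
label sets would force all coordinates `t i` of `z` to agree, hence to equal one, and a crossing
label set with three elements would then give the value `1 + 1 + 1 ≠ 0`. -/
theorem exists_isCrossingFunctional_apply_eq_one {n : ℕ} (hn : 5 ≤ n) {z : FTwoSpace n}
    (hz : z ≠ 0) : ∃ g : FTwoSpace n →ₗ[ZMod 2] ZMod 2, IsCrossingFunctional g ∧ g z = 1 := by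
  by_contra! hcon
  have hzero : ∀ g : FTwoSpace n →ₗ[ZMod 2] ZMod 2, IsCrossingFunctional g → g z = 0 :=
    fun g hg => by_contra fun h => hcon g hg (ZMod.eq_one_of_ne_zero_two h)
  let t : Fin n → ZMod 2 := fun i => labelFunctional (Pi.single i 1) z
  have pair : ∀ a b c d : Fin n, a < b → b < c → c < d → t a = t c ∧ t b = t d := by
    intro a b c d hab hbc hcd
    have h1 := hzero _ (isCrossingFunctional_pair hab hbc hcd).1
    have h2 := hzero _ (isCrossingFunctional_pair hab hbc hcd).2
    rw [labelFunctional_add, LinearMap.add_apply] at h1 h2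
    exact ⟨ZMod.eq_of_add_eq_zero_two h1, ZMod.eq_of_add_eq_zero_two h2⟩
  have hconst : ∀ i : Fin n, t i = t ⟨0, by omega⟩ := by
    have mid : ∀ i : Fin n, 2 ≤ (i : ℕ) → (i : ℕ) + 2 ≤ n → t i = t ⟨0, by omega⟩ := by
      intro i h2 hi
      exact (pair ⟨0, by omega⟩ ⟨1, by omega⟩ i ⟨i + 1, by omega⟩ (by simp)
        (by rw [Fin.lt_def]; simp only []; omega) (by rw [Fin.lt_def]; simp)).1.symm
    -- The label at position `3` satisfies the hypothesis of `mid` precisely because `5 ≤ n`.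
    have one : t ⟨1, by omega⟩ = t ⟨0, by omega⟩ := by
      rw [← mid ⟨3, by omega⟩ (by simp) (by simp only []; omega)]
      exact (pair ⟨0, by omega⟩ ⟨1, by omega⟩ ⟨2, by omega⟩ ⟨3, by omega⟩ (by simp) (by simp)
        (by simp)).2
    intro i
    rcases Nat.lt_or_ge i 2 with hi | hi
    · rcases Nat.lt_or_ge i 1 with hi' | hi'
      · congr 1
        exact Fin.ext (by simp only []; omega)
      · rw [← one]
        congr 1
        exact Fin.ext (by simp only []; omega)
    · rcases Nat.lt_or_ge n (i + 2) with hi' | hi'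
      · rw [← one]
        exact (pair ⟨0, by omega⟩ ⟨1, by omega⟩ ⟨2, by omega⟩ i (by simp) (by simp)
          (by rw [Fin.lt_def]; simp only []; omega)).2.symm
      · exact mid i hi hi'
  obtain ⟨i, hi⟩ := exists_labelFunctional_single_ne_zero hz
  have h0 : ∀ j, t j = 1 := fun j => by
    rw [hconst j, ← hconst i]
    exact ZMod.eq_one_of_ne_zero_two hi
  let v : ℕ → Fin n := fun k => ⟨k % n, Nat.mod_lt _ (by omega)⟩
  have hv : ∀ k < 5, ∀ l < 5, v k = v l ↔ k = l := fun k hk l hl => by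
    simp only [v, Fin.mk.injEq]
    rw [Nat.mod_eq_of_lt (by omega), Nat.mod_eq_of_lt (by omega)]
  have hlt : ∀ k, k < 4 → v k < v (k + 1) := fun k hk => by
    simp only [v, Fin.mk_lt_mk]
    rw [Nat.mod_eq_of_lt (by omega), Nat.mod_eq_of_lt (by omega)]
    omega
  -- The set `{0, 2, 4}` alternates on the positions `0, 1, 2, 3`; the fifth label makes its
  -- cardinality odd.
  have h3 := hzero _ (isCrossingFunctional_labelFunctional
    (S := Pi.single (v 0) 1 + Pi.single (v 2) 1 + Pi.single (v 4) 1)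
    (hlt 0 (by simp)) (hlt 1 (by simp)) (hlt 2 (by simp)) (by simp [hv])
    (by simp [hv]) (by simp [hv]))
  rw [labelFunctional_add, labelFunctional_add, LinearMap.add_apply, LinearMap.add_apply] at h3
  change t _ + t _ + t _ = 0 at h3
  rw [h0, h0, h0] at h3
  exact absurd h3 (by decide)

theorem functional_eq_zero_of_edgeBasisVector {n : ℕ} {g : FTwoSpace n →ₗ[ZMod 2] ZMod 2}
    (h : ∀ i, g (edgeBasisVector n i) = 0) : g = 0 := by
  refine LinearMap.pi_ext' fun k => LinearMap.ext_ring ?_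
  have := h ⟨k, by omega⟩
  have h2 : edgeBasisVector n ⟨k, by omega⟩ = Pi.single k 1 := by
    funext l
    simp [edgeBasisVector, Pi.single_apply, Fin.ext_iff]
  rw [h2] at this
  simpa using this

theorem edgeBasisVector_last {n : ℕ} (h : n - 1 < n) : edgeBasisVector n ⟨n - 1, h⟩ = 0 := by
  funext k
  have : (k : ℕ) ≠ n - 1 := by omega
  simp [edgeBasisVector, this]

/-- Two vectors of weight four that share three labels and otherwise use `i` and the last label
differ by `eᵢ`. Since `g eᵢ = 1`, the functional takes the value one on exactly one of them. -/
theorem exists_not_isEdgeVector_apply_eq_one {n : ℕ} (hn : 5 ≤ n)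
    {g : FTwoSpace n →ₗ[ZMod 2] ZMod 2} (hg : g ≠ 0) :
    ∃ x : FTwoSpace n, ¬ IsEdgeVector x ∧ g x = 1 := by
  obtain ⟨i, hi⟩ : ∃ i, g (edgeBasisVector n i) ≠ 0 := by
    by_contra! h
    exact hg (functional_eq_zero_of_edgeBasisVector h)
  let l : Fin n := ⟨n - 1, by omega⟩
  have hl : edgeBasisVector n l = 0 := edgeBasisVector_last _
  have hil : i ≠ l := fun h => hi (by rw [h, hl, map_zero])
  obtain ⟨T, hT, hTc⟩ : ∃ T ⊆ ({i, l}ᶜ : Finset (Fin n)), T.card = 3 := by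
    apply Finset.exists_subset_card_eq
    rw [Finset.card_compl, Fintype.card_fin, Finset.card_pair hil]
    omega
  obtain ⟨a, b, c, hab, hac, hbc, rfl⟩ := Finset.card_eq_three.mp hTc
  have ha := hT (show a ∈ ({a, b, c} : Finset (Fin n)) by simp)
  have hb := hT (show b ∈ ({a, b, c} : Finset (Fin n)) by simp)
  have hc := hT (show c ∈ ({a, b, c} : Finset (Fin n)) by simp)
  simp only [Finset.mem_compl, Finset.mem_insert, Finset.mem_singleton, not_or] at ha hb hc
  have h1 := not_isEdgeVector_of_ne (Ne.symm ha.1) (Ne.symm hb.1) (Ne.symm hc.1) hab hac hbc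
  have h2 := not_isEdgeVector_of_ne (Ne.symm ha.2) (Ne.symm hb.2) (Ne.symm hc.2) hab hac hbc
  have hgi := ZMod.eq_one_of_ne_zero_two hi
  by_cases hs : g (edgeBasisVector n l + edgeBasisVector n a
      + (edgeBasisVector n b + edgeBasisVector n c)) = 0
  · refine ⟨_, h1, ?_⟩
    simp only [map_add, hl, zero_add, hgi] at hs ⊢
    rw [add_assoc, hs, add_zero]
  · exact ⟨_, h2, ZMod.eq_one_of_ne_zero_two hs⟩

/-! ### Existence of a suitable opposite pair -/

/-- The subspace is the image of a non-crossing partition. -/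
def IsNCPSubspace {n : ℕ} (U : Submodule (ZMod 2) (FTwoSpace n)) : Prop :=
  ∃ P : Setoid (Fin n), IsNonCrossing P ∧ partitionSubspace P = U

theorem isEdgeVector_zero {n : ℕ} (hn : 0 < n) : IsEdgeVector (0 : FTwoSpace n) :=
  ⟨⟨0, hn⟩, ⟨0, hn⟩, (FTwoSpace.add_self _).symm⟩

/-- Two opposite vertices, of dimension and of codimension one, through which a geodesic containing
the subspace `p` can be drawn outside of the non-crossing partition complex. -/
def HasOppositePair {n : ℕ} (p : Submodule (ZMod 2) (FTwoSpace n)) : Prop :=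
  ∃ (x : FTwoSpace n) (g : FTwoSpace n →ₗ[ZMod 2] ZMod 2),
    ¬ IsEdgeVector x ∧ IsCrossingFunctional g ∧ g x = 1 ∧
    ((x ∈ p ∧ p ⊓ LinearMap.ker g ≠ ⊥ ∧ ¬ IsNCPSubspace (p ⊓ LinearMap.ker g)) ∨
      (p ≤ LinearMap.ker g ∧ p ⊔ Submodule.span (ZMod 2) {x} ≠ ⊤ ∧
        ¬ IsNCPSubspace (p ⊔ Submodule.span (ZMod 2) {x})))

/-- A subspace with an element `y` on which a functional `f` that vanishes on all the edge vectors
of the subspace does not vanish. -/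
theorem not_isNCPSubspace_of_functional {n : ℕ} {U : Submodule (ZMod 2) (FTwoSpace n)}
    {f : FTwoSpace n →ₗ[ZMod 2] ZMod 2} {y : FTwoSpace n} (hy : y ∈ U) (hfy : f y = 1)
    (hf : ∀ v ∈ U, IsEdgeVector v → f v = 0) : ¬ IsNCPSubspace U := by
  rintro ⟨P, -, rfl⟩
  have := partitionSubspace_le_ker (P := P) (f := f) (fun i j h => hf _ h ⟨i, j, rfl⟩) hy
  rw [LinearMap.mem_ker, hfy] at this
  exact one_ne_zero this

theorem not_isNCPSubspace_of_crossing {n : ℕ} {U : Submodule (ZMod 2) (FTwoSpace n)}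
    {a b c d : Fin n} (hab : a < b) (hbc : b < c) (hcd : c < d)
    (hac : edgeBasisVector n a + edgeBasisVector n c ∈ U)
    (hbd : edgeBasisVector n b + edgeBasisVector n d ∈ U)
    (h : edgeBasisVector n a + edgeBasisVector n b ∉ U) : ¬ IsNCPSubspace U := by
  rintro ⟨P, hP, rfl⟩
  exact h (hP.edge_mem hab hbc hcd hac hbd)

theorem mem_sup_span_singleton_zmod_two {n : ℕ} {U : Submodule (ZMod 2) (FTwoSpace n)}
    {x v : FTwoSpace n} :
    v ∈ U ⊔ Submodule.span (ZMod 2) {x} ↔ v ∈ U ∨ v + x ∈ U := by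
  rw [Submodule.mem_sup]
  constructor
  · rintro ⟨u, hu, w, hw, rfl⟩
    obtain ⟨c, rfl⟩ := Submodule.mem_span_singleton.mp hw
    by_cases hc : c = 0
    · left
      rwa [hc, zero_smul, add_zero]
    · right
      rwa [ZMod.eq_one_of_ne_zero_two hc, one_smul, add_assoc, FTwoSpace.add_self, add_zero]
  · rintro (h | h)
    · exact ⟨v, h, 0, Submodule.zero_mem _, add_zero v⟩
    · exact ⟨v + x, h, x, Submodule.mem_span_singleton_self x, by
        rw [add_assoc, FTwoSpace.add_self, add_zero]⟩

theorem edge_ne_zero {n : ℕ} {i j : Fin n} (h : i ≠ j) :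
    edgeBasisVector n i + edgeBasisVector n j ≠ 0 := by
  intro h0
  have := labelFunctional_edge (Pi.single i 1) i j
  rw [h0, map_zero] at this
  simp [h.symm] at this

/-- Take for `g` the indicator of two labels `a`, `c` that form a diagonal of a pentagon and at
which the coordinates of `y` agree, so that `g y = 0`. The vector `x` of weight four supported on
all five labels except `c` meets `{a, c}` once, so `g x = 1`. -/
theorem exists_crossing_line_complement {n : ℕ} (hn : 5 ≤ n) (y : FTwoSpace n) :
    ∃ (x : FTwoSpace n) (g : FTwoSpace n →ₗ[ZMod 2] ZMod 2),
      ¬ IsEdgeVector x ∧ IsCrossingFunctional g ∧ g x = 1 ∧ g y = 0 := by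
  let v : ℕ → Fin n := fun k => ⟨k % n, Nat.mod_lt _ (by omega)⟩
  have hv : ∀ k < 5, ∀ l < 5, v k = v l ↔ k = l := fun k hk l hl => by
    simp only [v, Fin.mk.injEq]
    rw [Nat.mod_eq_of_lt (by omega), Nat.mod_eq_of_lt (by omega)]
  have hlt : ∀ k l, k < l → l < 5 → v k < v l := fun k l hk hl => by
    simp only [v, Fin.mk_lt_mk]
    rwa [Nat.mod_eq_of_lt (by omega), Nat.mod_eq_of_lt (by omega)]
  let t : ℕ → ZMod 2 := fun k => labelFunctional (Pi.single (v k) 1) y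
  have key : ∀ a c i j k, ({a, c, i, j, k} : Finset ℕ) = Finset.range 5 →
      IsCrossingFunctional (labelFunctional (Pi.single (v a) 1 + Pi.single (v c) 1)) →
      t a = t c → ∃ (x : FTwoSpace n) (g : FTwoSpace n →ₗ[ZMod 2] ZMod 2),
      ¬ IsEdgeVector x ∧ IsCrossingFunctional g ∧ g x = 1 ∧ g y = 0 := by
    intro a c i j k hS hcr ht
    have hlt5 : ∀ z, (z = a ∨ z = c ∨ z = i ∨ z = j ∨ z = k) → z < 5 := fun z hz => by
      rw [← Finset.mem_range, ← hS]
      simpa using hz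
    have ha := hlt5 a (by simp)
    have hc := hlt5 c (by simp)
    have hi := hlt5 i (by simp)
    have hj := hlt5 j (by simp)
    have hk := hlt5 k (by simp)
    have hd : a ≠ c ∧ a ≠ i ∧ a ≠ j ∧ a ≠ k ∧ c ≠ i ∧ c ≠ j ∧ c ≠ k ∧ i ≠ j ∧ i ≠ k ∧ j ≠ k := by
      have hcard := congrArg Finset.card hS
      rw [Finset.card_range] at hcard
      have h4 : ∀ p q r s : ℕ, ({p, q, r, s} : Finset ℕ).card ≠ 5 :=
        fun p q r s => (Finset.card_le_four.trans_lt (by norm_num)).ne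
      refine ⟨?_, ?_, ?_, ?_, ?_, ?_, ?_, ?_, ?_, ?_⟩ <;> rintro rfl <;>
        exact h4 _ _ _ _ (by simpa using hcard)
    obtain ⟨h1, h2, h3, h4, h5, h6, h7, h8, h9, h10⟩ := hd
    refine ⟨edgeBasisVector n (v a) + edgeBasisVector n (v i)
      + (edgeBasisVector n (v j) + edgeBasisVector n (v k)), _, ?_, hcr, ?_, ?_⟩
    · apply not_isEdgeVector_of_ne <;> rw [Ne, hv _ (by assumption) _ (by assumption)] <;>
        assumption
    · rw [map_add, labelFunctional_edge, labelFunctional_edge]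
      simp [hv, ha, hc, hi, hj, hk, h1, h2.symm, h3.symm, h4.symm, h5.symm,
        h6.symm, h7.symm]
    · rw [labelFunctional_add, LinearMap.add_apply]
      change t a + t c = 0
      rw [ht, CharTwo.add_self_eq_zero]
  -- The five diagonals of the pentagon form a cycle of odd length, so a colouring of the vertices
  -- by two values is constant on some diagonal.
  have hor : t 0 = t 2 ∨ t 2 = t 4 ∨ t 1 = t 4 ∨ t 1 = t 3 ∨ t 0 = t 3 := by
    generalize t 0 = t0, t 1 = t1, t 2 = t2, t 3 = t3, t 4 = t4
    revert t0 t1 t2 t3 t4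
    decide
  rcases hor with h | h | h | h | h
  · exact key 0 2 1 3 4 (by decide) (isCrossingFunctional_pair (hlt 0 1 (by simp) (by simp))
      (hlt 1 2 (by simp) (by simp)) (hlt 2 3 (by simp) (by simp))).1 h
  · exact key 2 4 0 1 3 (by decide) (isCrossingFunctional_pair (hlt 1 2 (by simp) (by simp))
      (hlt 2 3 (by simp) (by simp)) (hlt 3 4 (by simp) (by simp))).2 h
  · exact key 1 4 0 2 3 (by decide) (isCrossingFunctional_pair (hlt 0 1 (by simp) (by simp))
      (hlt 1 2 (by simp) (by simp)) (hlt 2 4 (by simp) (by simp))).2 h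
  · exact key 1 3 0 2 4 (by decide) (isCrossingFunctional_pair (hlt 0 1 (by simp) (by simp))
      (hlt 1 2 (by simp) (by simp)) (hlt 2 3 (by simp) (by simp))).2 h
  · exact key 0 3 1 2 4 (by decide) (isCrossingFunctional_pair (hlt 0 1 (by simp) (by simp))
      (hlt 1 3 (by simp) (by simp)) (hlt 3 4 (by simp) (by simp))).1 h

/-- The case of a line. The nonzero vectors of the plane `⟨x, y⟩` are `x`, `y` and `x + y`, of which
only `x + y` can be an edge vector; so edge vectors do not span the plane. It is proper because `n -
1 ≥ 4`. -/
theorem hasOppositePair_span_singleton {n : ℕ} (hn : 5 ≤ n) {y : FTwoSpace n}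
    (hy : ¬ IsEdgeVector y) : HasOppositePair (Submodule.span (ZMod 2) {y}) := by
  obtain ⟨x, g, hx, hg, hgx, hgy⟩ := exists_crossing_line_complement hn y
  have hxy : x + y ≠ 0 := fun h => by
    have := congrArg g h
    rw [map_add, hgx, hgy, map_zero, add_zero] at this
    exact one_ne_zero this
  have hnot : x ∉ Submodule.span (ZMod 2) {x + y} := by
    intro h
    obtain ⟨c, hc⟩ := Submodule.mem_span_singleton.mp h
    by_cases hc0 : c = 0
    · rw [hc0, zero_smul] at hc
      exact hx (hc ▸ isEdgeVector_zero (by omega))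
    · rw [ZMod.eq_one_of_ne_zero_two hc0, one_smul, add_eq_left] at hc
      exact hy (hc ▸ isEdgeVector_zero (by omega))
  obtain ⟨f, hfx, hf⟩ := Submodule.exists_le_ker_of_notMem (K := ZMod 2) hnot
  have hfxy : f (x + y) = 0 := hf (Submodule.mem_span_singleton_self _)
  refine ⟨x, g, hx, hg, hgx, .inr ⟨?_, ?_, ?_⟩⟩
  · rwa [Submodule.span_singleton_le_iff_mem, LinearMap.mem_ker]
  · intro htop
    have h1 := Submodule.finrank_add_le_finrank_add_finrank (Submodule.span (ZMod 2) {y})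
      (Submodule.span (ZMod 2) {x})
    have h2 := finrank_span_le_card (R := ZMod 2) ({y} : Set (FTwoSpace n))
    have h3 := finrank_span_le_card (R := ZMod 2) ({x} : Set (FTwoSpace n))
    rw [htop, finrank_top, Module.finrank_fin_fun] at h1
    simp only [Set.toFinset_singleton, Finset.card_singleton] at h2 h3
    omega
  · refine not_isNCPSubspace_of_functional (f := f) (y := x)
      (Submodule.mem_sup_right (Submodule.mem_span_singleton_self x))
      (ZMod.eq_one_of_ne_zero_two hfx) fun v hv hedge => ?_
    have hspan : ∀ w ∈ Submodule.span (ZMod 2) {y}, w = 0 ∨ w = y := fun w hw => by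
      obtain ⟨c, rfl⟩ := Submodule.mem_span_singleton.mp hw
      by_cases hc : c = 0
      · exact .inl (by rw [hc, zero_smul])
      · exact .inr (by rw [ZMod.eq_one_of_ne_zero_two hc, one_smul])
    have hadd : ∀ w : FTwoSpace n, v + x = w → v = w + x := fun w hw => by
      rw [← hw, add_assoc, FTwoSpace.add_self, add_zero]
    rcases mem_sup_span_singleton_zmod_two.mp hv with h | h
    · rcases hspan _ h with rfl | rfl
      · exact map_zero f
      · exact (hy hedge).elim
    · rcases hspan _ h with h | h
      · have := hadd _ h
        rw [zero_add] at this
        exact (hx (this ▸ hedge)).elim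
      · rw [hadd _ h, add_comm]
        exact hfxy

/-- Exactly one of `y` and `y + z` lies in `ker g`, and `f` is one on both. The one outside `ker g`
serves as `x`; it is no edge vector because of `f`. The one inside shows that `p ⊓ ker g` is not
spanned by edge vectors. -/
theorem hasOppositePair_of_not_spanned {n : ℕ} (hn : 5 ≤ n)
    {p : Submodule (ZMod 2) (FTwoSpace n)} {f : FTwoSpace n →ₗ[ZMod 2] ZMod 2}
    {y z : FTwoSpace n} (hf : ∀ v ∈ p, IsEdgeVector v → f v = 0) (hy : y ∈ p) (hfy : f y = 1)
    (hz : z ∈ p) (hz0 : z ≠ 0) (hfz : f z = 0) : HasOppositePair p := by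
  obtain ⟨g, hg, hgz⟩ := exists_isCrossingFunctional_apply_eq_one hn hz0
  obtain ⟨y₀, y₁, hy₀, hy₁, hf₀, hf₁, hg₀, hg₁⟩ : ∃ y₀ y₁, y₀ ∈ p ∧ y₁ ∈ p ∧ f y₀ = 1 ∧ f y₁ = 1 ∧
      g y₀ = 0 ∧ g y₁ = 1 := by
    have hyz : f (y + z) = 1 := by rw [map_add, hfy, hfz, add_zero]
    by_cases h : g y = 0
    · exact ⟨y, y + z, hy, add_mem hy hz, hfy, hyz, h, by rw [map_add, h, hgz, zero_add]⟩
    · have h := ZMod.eq_one_of_ne_zero_two h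
      exact ⟨y + z, y, add_mem hy hz, hy, hyz, hfy,
        by rw [map_add, h, hgz, CharTwo.add_self_eq_zero], h⟩
  have hmem : y₀ ∈ p ⊓ LinearMap.ker g := ⟨hy₀, hg₀⟩
  refine ⟨y₁, g, fun h => ?_, hg, hg₁, .inl ⟨hy₁, fun h => ?_, ?_⟩⟩
  · exact one_ne_zero (hf₁.symm.trans (hf _ hy₁ h))
  · rw [h, Submodule.mem_bot] at hmem
    rw [hmem, map_zero] at hf₀
    exact zero_ne_one hf₀
  · exact not_isNCPSubspace_of_functional hmem hf₀ fun v hv => hf v hv.1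

/-- Here `p` can be enlarged by a line without absorbing the missing edge `e`: a functional `h` that
kills `p` and `e` but not `x` keeps `e` out of `p ⊔ ⟨x⟩`. -/
theorem hasOppositePair_of_crossing_of_ne_top {n : ℕ} (hn : 5 ≤ n)
    {p : Submodule (ZMod 2) (FTwoSpace n)} {a b c d : Fin n}
    (hab : a < b) (hbc : b < c) (hcd : c < d)
    (hac : edgeBasisVector n a + edgeBasisVector n c ∈ p)
    (hbd : edgeBasisVector n b + edgeBasisVector n d ∈ p)
    (hnot : edgeBasisVector n a + edgeBasisVector n b ∉ p)
    (htop : p ⊔ Submodule.span (ZMod 2) {edgeBasisVector n a + edgeBasisVector n b} ≠ ⊤) :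
    HasOppositePair p := by
  set e := edgeBasisVector n a + edgeBasisVector n b with he
  obtain ⟨h, hh0, hh⟩ := Submodule.exists_le_ker_of_lt_top (K := ZMod 2) _ htop.lt_top
  have hhp : ∀ v ∈ p, h v = 0 := fun v hv => hh (Submodule.mem_sup_left hv)
  have hhe : h e = 0 := hh (Submodule.mem_sup_right (Submodule.mem_span_singleton_self _))
  obtain ⟨x, hx, hhx⟩ := exists_not_isEdgeVector_apply_eq_one hn hh0
  have hex : e ∉ p ⊔ Submodule.span (ZMod 2) {x} := by
    intro hmem
    rcases mem_sup_span_singleton_zmod_two.mp hmem with h1 | h1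
    · exact hnot h1
    · have := hhp _ h1
      rw [map_add, hhe, hhx, zero_add] at this
      exact one_ne_zero this
  obtain ⟨g₀, hg₀, hg₀p⟩ := Submodule.exists_le_ker_of_notMem (K := ZMod 2) hnot
  -- Adding `h` changes the value at `x` but neither the value at `e` nor those on `p`.
  obtain ⟨g, hgp, hge, hgx⟩ : ∃ g : FTwoSpace n →ₗ[ZMod 2] ZMod 2,
      p ≤ LinearMap.ker g ∧ g e ≠ 0 ∧ g x = 1 := by
    by_cases h1 : g₀ x = 0
    · refine ⟨g₀ + h, fun v hv => ?_, ?_, ?_⟩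
      · rw [LinearMap.mem_ker, LinearMap.add_apply, hg₀p hv, hhp v hv, add_zero]
      · rwa [LinearMap.add_apply, hhe, add_zero]
      · rw [LinearMap.add_apply, h1, hhx, zero_add]
    · exact ⟨g₀, hg₀p, hg₀, ZMod.eq_one_of_ne_zero_two h1⟩
  refine ⟨x, g, hx, ⟨a, b, c, d, hab, hbc, hcd, ?_, ?_, fun h1 => hge ?_⟩, hgx,
    .inr ⟨hgp, fun h1 => hex (h1 ▸ Submodule.mem_top), ?_⟩⟩
  · exact ZMod.eq_of_add_eq_zero_two (by rw [← map_add]; exact hgp hac)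
  · exact ZMod.eq_of_add_eq_zero_two (by rw [← map_add]; exact hgp hbd)
  · rw [he, map_add, h1, CharTwo.add_self_eq_zero]
  · exact not_isNCPSubspace_of_crossing hab hbc hcd (Submodule.mem_sup_left hac)
      (Submodule.mem_sup_left hbd) hex

/-- A hyperplane cannot be enlarged, so it is cut down. Altering `f` at a fifth label `i` leaves the
crossing on `a, b, c, d` intact, so `ker f ⊓ ker (f + δ)` still contains `ac` and `bd` and avoids
`ab`. -/
theorem hasOppositePair_ker {n : ℕ} (hn : 5 ≤ n) {f : FTwoSpace n →ₗ[ZMod 2] ZMod 2}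
    (hf : IsCrossingFunctional f) : HasOppositePair (LinearMap.ker f) := by
  obtain ⟨a, b, c, d, hab, hbc, hcd, hac, hbd, hne⟩ := hf
  obtain ⟨i, hi⟩ : ∃ i, i ∉ ({a, b, c, d} : Finset (Fin n)) := by
    by_contra! h
    have h1 := Finset.card_le_card (fun j _ => h j : (Finset.univ : Finset (Fin n)) ⊆ _)
    rw [Finset.card_univ, Fintype.card_fin] at h1
    exact absurd (h1.trans Finset.card_le_four) (by omega)
  simp only [Finset.mem_insert, Finset.mem_singleton, not_or] at hi
  obtain ⟨hia, hib, hic, hid⟩ := hi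
  set δ := labelFunctional (Pi.single i (1 : ZMod 2)) with hδ
  have hδe : ∀ j k, j ≠ i → k ≠ i → δ (edgeBasisVector n j) = δ (edgeBasisVector n k) := by
    intro j k hj hk
    rw [hδ, labelFunctional_edgeBasisVector, labelFunctional_edgeBasisVector,
      Pi.single_eq_of_ne hj, Pi.single_eq_of_ne hk]
  have hδi : ∀ j, j ≠ i → δ (edgeBasisVector n i + edgeBasisVector n j) = 1 := by
    intro j hj
    rw [hδ, labelFunctional_edge, Pi.single_eq_same, Pi.single_eq_of_ne hj, add_zero]
  -- The functional `f` takes only two values on the basis vectors, so `i` is on the side of `a` or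
  -- on that of `b`. Pair it with that label, and add the edge `bd` or `ac` respectively, on which
  -- `f` vanishes.
  obtain ⟨x, hx, hfx, hδx⟩ : ∃ x, ¬ IsEdgeVector x ∧ f x = 0 ∧ δ x = 1 := by
    by_cases h : f (edgeBasisVector n i) = f (edgeBasisVector n a)
    · refine ⟨_, not_isEdgeVector_of_ne hia hib hid hab.ne (hab.trans (hbc.trans hcd)).ne
        (hbc.trans hcd).ne, ?_, ?_⟩
      · simp only [map_add, h, hbd, CharTwo.add_self_eq_zero]
      · rw [map_add, hδi a (Ne.symm hia), map_add, hδe b d (Ne.symm hib) (Ne.symm hid),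
          CharTwo.add_self_eq_zero, add_zero]
    · have h : f (edgeBasisVector n i) = f (edgeBasisVector n b) := by
        generalize f (edgeBasisVector n i) = r at *
        generalize f (edgeBasisVector n a) = s at *
        generalize f (edgeBasisVector n b) = t at *
        revert h hne
        clear * -
        revert r s t
        decide
      refine ⟨_, not_isEdgeVector_of_ne hib hia hic hab.ne' hbc.ne (hab.trans hbc).ne, ?_, ?_⟩
      · simp only [map_add, h, hac, CharTwo.add_self_eq_zero]
      · rw [map_add, hδi b (Ne.symm hib), map_add, hδe a c (Ne.symm hia) (Ne.symm hic),
          CharTwo.add_self_eq_zero, add_zero]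
  have hac' : (f + δ) (edgeBasisVector n a) = (f + δ) (edgeBasisVector n c) := by
    rw [LinearMap.add_apply, LinearMap.add_apply, hac, hδe a c (Ne.symm hia) (Ne.symm hic)]
  have hbd' : (f + δ) (edgeBasisVector n b) = (f + δ) (edgeBasisVector n d) := by
    rw [LinearMap.add_apply, LinearMap.add_apply, hbd, hδe b d (Ne.symm hib) (Ne.symm hid)]
  have hne' : (f + δ) (edgeBasisVector n a) ≠ (f + δ) (edgeBasisVector n b) := by
    rw [LinearMap.add_apply, LinearMap.add_apply, hδe a b (Ne.symm hia) (Ne.symm hib)]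
    exact fun h => hne (add_right_cancel h)
  have hmem : ∀ {j k}, f (edgeBasisVector n j) = f (edgeBasisVector n k) →
      (f + δ) (edgeBasisVector n j) = (f + δ) (edgeBasisVector n k) →
      edgeBasisVector n j + edgeBasisVector n k ∈ LinearMap.ker f ⊓ LinearMap.ker (f + δ) := by
    intro j k h1 h2
    rw [Submodule.mem_inf, LinearMap.mem_ker, LinearMap.mem_ker, map_add, map_add, h1, h2,
      CharTwo.add_self_eq_zero, CharTwo.add_self_eq_zero]
    exact ⟨rfl, rfl⟩
  refine ⟨x, f + δ, hx, ⟨a, b, c, d, hab, hbc, hcd, hac', hbd', hne'⟩, ?_,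
    .inl ⟨hfx, fun h => ?_, ?_⟩⟩
  · rw [LinearMap.add_apply, hfx, hδx, zero_add]
  · have := hmem hac hac'
    rw [h, Submodule.mem_bot] at this
    exact edge_ne_zero (hab.trans hbc).ne this
  · refine not_isNCPSubspace_of_crossing hab hbc hcd (hmem hac hac') (hmem hbd hbd') fun h => ?_
    have h1 := LinearMap.mem_ker.mp (Submodule.mem_inf.mp h).1
    rw [map_add] at h1
    exact hne (ZMod.eq_of_add_eq_zero_two h1)

/-- The partition of the labels by the edge vectors in a subspace. -/
def edgeSetoid {n : ℕ} (p : Submodule (ZMod 2) (FTwoSpace n)) : Setoid (Fin n) where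
  r i j := edgeBasisVector n i + edgeBasisVector n j ∈ p
  iseqv :=
    { refl := fun i => by
        rw [FTwoSpace.add_self]
        exact p.zero_mem
      symm := fun h => by rwa [add_comm]
      trans := fun {i j k} h h' => by
        have := p.add_mem h h'
        rwa [add_assoc, ← add_assoc (edgeBasisVector n j), FTwoSpace.add_self, zero_add] at this }

theorem partitionSubspace_edgeSetoid_le {n : ℕ} (p : Submodule (ZMod 2) (FTwoSpace n)) :
    partitionSubspace (edgeSetoid p) ≤ p :=
  iSup_le fun _ => iSup_le fun _ => iSup_le fun h =>
    (Submodule.span_singleton_le_iff_mem _ _).mpr h.2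

theorem hasOppositePair_of_not_isNCPSubspace {n : ℕ} (hn : 5 ≤ n)
    {p : Submodule (ZMod 2) (FTwoSpace n)} (hp : ¬ IsNCPSubspace p) : HasOppositePair p := by
  by_cases hpart : p ≤ partitionSubspace (edgeSetoid p)
  · have heq := le_antisymm (partitionSubspace_edgeSetoid_le p) hpart
    obtain ⟨a, b, c, d, hab, hbc, hcd, hac, hbd, hne⟩ :
        ∃ a b c d : Fin n, a < b ∧ b < c ∧ c < d ∧ edgeSetoid p a c ∧ edgeSetoid p b d ∧
          ¬ edgeSetoid p a b :=
      not_not.mp fun h => hp ⟨edgeSetoid p, h, heq⟩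
    by_cases htop : p ⊔ Submodule.span (ZMod 2) {edgeBasisVector n a + edgeBasisVector n b} = ⊤
    · obtain ⟨f, hf, hpf⟩ := Submodule.exists_le_ker_of_notMem (K := ZMod 2) hne
      -- A single vector completes `p` to the whole space, so `p` is a hyperplane.
      have hker : LinearMap.ker f = p := by
        refine le_antisymm (fun v hv => ?_) hpf
        have hv' : v ∈ p ⊔ Submodule.span (ZMod 2) {edgeBasisVector n a + edgeBasisVector n b} :=
          htop ▸ Submodule.mem_top
        rcases mem_sup_span_singleton_zmod_two.mp hv' with h | h
        · exact h
        · have h1 := hpf h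
          rw [LinearMap.mem_ker, map_add, LinearMap.mem_ker.mp hv, zero_add] at h1
          exact (hf h1).elim
      rw [← hker]
      refine hasOppositePair_ker hn ⟨a, b, c, d, hab, hbc, hcd, ?_, ?_, fun h => hf ?_⟩
      · exact ZMod.eq_of_add_eq_zero_two (by rw [← map_add]; exact hpf hac)
      · exact ZMod.eq_of_add_eq_zero_two (by rw [← map_add]; exact hpf hbd)
      · rw [map_add, h, CharTwo.add_self_eq_zero]
    · exact hasOppositePair_of_crossing_of_ne_top hn hab hbc hcd hac hbd hne htop
  · obtain ⟨y, hy, hynot⟩ := SetLike.not_le_iff_exists.mp hpart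
    obtain ⟨f, hfy, hf⟩ := Submodule.exists_le_ker_of_notMem (K := ZMod 2) hynot
    have hfy := ZMod.eq_one_of_ne_zero_two hfy
    have hedge : ∀ v ∈ p, IsEdgeVector v → f v = 0 := by
      rintro _ hv ⟨i, j, rfl⟩
      exact hf (edge_mem_partitionSubspace (P := edgeSetoid p) hv)
    by_cases hz : ∃ z ∈ p, z ≠ 0 ∧ f z = 0
    · obtain ⟨z, hz, hz0, hfz⟩ := hz
      exact hasOppositePair_of_not_spanned hn hedge hy hfy hz hz0 hfz
    · push Not at hz
      -- Now `f` is injective on `p` with values in `𝔽₂`, so `p` has only one nonzero vector.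
      have hspan : p = Submodule.span (ZMod 2) {y} := by
        refine le_antisymm (fun v hv => ?_) ((Submodule.span_singleton_le_iff_mem _ _).mpr hy)
        by_cases hv0 : v = 0
        · rw [hv0]
          exact Submodule.zero_mem _
        · have h1 := ZMod.eq_one_of_ne_zero_two (hz v hv hv0)
          have h2 : v + y = 0 := by
            by_contra h
            refine hz _ (p.add_mem hv hy) h ?_
            rw [map_add, h1, hfy, CharTwo.add_self_eq_zero]
          have h3 : v = y := by
            rw [← add_zero v, ← FTwoSpace.add_self y, ← add_assoc, h2, zero_add]
          rw [h3]
          exact Submodule.mem_span_singleton_self y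
      rw [hspan]
      refine hasOppositePair_span_singleton hn fun h => ?_
      rw [hedge y hy h] at hfy
      exact zero_ne_one hfy
/-! ## The angle to a vertex of rank one -/

namespace Building

theorem sum_fin_ite_lt {m i : ℕ} (hi : i ≤ m) :
    ∑ k : Fin m, (if (k : ℕ) < i then (1 : ℝ) else 0) = i := by
  rw [Fin.sum_univ_eq_sum_range (fun k => if k < i then (1 : ℝ) else 0) m, Finset.sum_boole]
  congr 1
  rw [show (Finset.range m).filter (· < i) = Finset.range i by
    ext k; simp only [Finset.mem_filter, Finset.mem_range]; omega, Finset.card_range]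

theorem inner_chamberVector {n i j : ℕ} (hij : i ≤ j) (hj : j ≤ n - 1) (hn : 0 < n - 1) :
    inner ℝ (chamberVector n i) (chamberVector n j) = (i : ℝ) - i * j / ((n - 1 : ℕ) : ℝ) := by
  have hm : ((n - 1 : ℕ) : ℝ) ≠ 0 := by exact_mod_cast hn.ne'
  have h : ∀ k : Fin (n - 1), inner ℝ (chamberVector n i k) (chamberVector n j k)
      = (if (k : ℕ) < i then (1 : ℝ) else 0) * (1 - j / ((n - 1 : ℕ) : ℝ))
        - (if (k : ℕ) < j then (1 : ℝ) else 0) * (i / ((n - 1 : ℕ) : ℝ))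
        + i / ((n - 1 : ℕ) : ℝ) * (j / ((n - 1 : ℕ) : ℝ)) := by
    intro k
    simp only [chamberVector, RCLike.inner_apply, conj_trivial]
    split_ifs <;> first | omega | ring1
  rw [PiLp.inner_apply, Finset.sum_congr rfl fun k _ => h k, Finset.sum_add_distrib,
    Finset.sum_sub_distrib, ← Finset.sum_mul, ← Finset.sum_mul, sum_fin_ite_lt (hij.trans hj),
    sum_fin_ite_lt hj, Finset.sum_const, Finset.card_univ, Fintype.card_fin, nsmul_eq_mul]
  field_simp
  ring

/-- The projection of the standard basis vector with index `k` to the space of vectors with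
coordinate sum zero. -/
def coordinateVector (n k : ℕ) : EuclideanSpace ℝ (Fin (n - 1)) :=
  chamberVector n (k + 1) - chamberVector n k

theorem inner_coordinateVector {n i k : ℕ} (hi : i ≤ n - 1) (hk : k < n - 1) :
    inner ℝ (coordinateVector n k) (chamberVector n i)
      = (if k < i then 1 else 0) - (i : ℝ) / ((n - 1 : ℕ) : ℝ) := by
  have hm : ((n - 1 : ℕ) : ℝ) ≠ 0 := by exact_mod_cast (by omega : n - 1 ≠ 0)
  unfold coordinateVector
  rw [inner_sub_left]
  split_ifs with h
  · rw [inner_chamberVector h hi (by omega), inner_chamberVector h.le hi (by omega)]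
    push_cast
    field_simp
    ring
  · rw [real_inner_comm, real_inner_comm _ (chamberVector n k),
      inner_chamberVector (by omega) (by omega) (by omega),
      inner_chamberVector (by omega) (by omega) (by omega)]
    push_cast
    field_simp
    ring

theorem norm_coordinateVector {n k : ℕ} (hk : k < n - 1) :
    ‖coordinateVector n k‖ = √(1 - 1 / ((n - 1 : ℕ) : ℝ)) := by
  have hm : ((n - 1 : ℕ) : ℝ) ≠ 0 := by exact_mod_cast (by omega : n - 1 ≠ 0)
  rw [← Real.sqrt_sq (norm_nonneg (coordinateVector n k)), ← real_inner_self_eq_norm_sq]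
  congr 1
  rw [show inner ℝ (coordinateVector n k) (coordinateVector n k)
      = inner ℝ (coordinateVector n k) (chamberVector n (k + 1))
        - inner ℝ (coordinateVector n k) (chamberVector n k) from inner_sub_right _ _ _,
    inner_coordinateVector (by omega) hk, inner_coordinateVector hk.le hk,
    if_pos (Nat.lt_succ_self k), if_neg (lt_irrefl k)]
  push_cast
  field_simp
  ring

/-- The ranks `0` and `n - 1` belong to no vertex. Their vectors vanish, which makes the first and
the last coordinate vector a vertex vector and the negative of one. -/
theorem chamberVector_zero (n : ℕ) : chamberVector n 0 = 0 := by
  ext k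
  simp [chamberVector]

theorem chamberVector_top {n : ℕ} (hn : 0 < n - 1) : chamberVector n (n - 1) = 0 := by
  have hm : ((n - 1 : ℕ) : ℝ) ≠ 0 := by exact_mod_cast hn.ne'
  ext k
  simp [chamberVector, div_self hm]

theorem eq_zero_of_smul_chamberVector_add {n i j : ℕ} (hi : 0 < i) (hij : i < j) (hj : j < n - 1)
    {s t : ℝ} (h : s • chamberVector n i + t • chamberVector n j = 0) : s = 0 ∧ t = 0 := by
  have key : ∀ k (hk : k < n - 1), s * ((if k < i then 1 else 0) - (i : ℝ) / ((n - 1 : ℕ) : ℝ))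
      + t * ((if k < j then 1 else 0) - (j : ℝ) / ((n - 1 : ℕ) : ℝ)) = 0 := fun k hk => by
    have := congrArg (fun v : EuclideanSpace ℝ (Fin (n - 1)) => v ⟨k, hk⟩) h
    simpa [chamberVector] using this
  -- The coordinates `0`, `i`, `j` come from the three ranges on which both indicators are constant;
  -- consecutive differences isolate `s` and `t`.
  have h0 := key 0 (by omega)
  have h1 := key i (by omega)
  have h2 := key j hj
  rw [if_pos hi, if_pos (by omega)] at h0
  rw [if_neg (by omega), if_pos hij] at h1
  rw [if_neg (by omega), if_neg (by omega)] at h2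
  constructor <;> linarith

variable {n : ℕ}

/-- The angle between a point of `Δ` and the vertex spanned by `x`. -/
def lineAngle (x : FTwoSpace n) (y : Building n) : ℝ :=
  open Classical in
  Real.arccos ((y.weight.sum fun U c => c * ((if x ∈ U.1 then 1 else 0)
    - (U.rank : ℝ) / ((n - 1 : ℕ) : ℝ))) / (√(1 - 1 / ((n - 1 : ℕ) : ℝ)) * ‖chart y‖))

theorem _root_.BuildingVertex.rank_lt (U : BuildingVertex n) : U.rank < n - 1 := by
  have := Submodule.finrank_lt U.2.2
  rwa [Module.finrank_fin_fun] at this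

theorem _root_.BuildingVertex.rank_pos (U : BuildingVertex n) : 0 < U.rank :=
  Module.finrank_pos_iff.mpr ((Submodule.nontrivial_iff_ne_bot).mpr U.2.1)

theorem _root_.BuildingVertex.rank_lt_rank {U U' : BuildingVertex n} (h : U < U') :
    U.rank < U'.rank :=
  Submodule.finrank_lt_finrank_of_lt h

/-- If `x` is nonzero and a chain is given, a basis adapted to the chain can be chosen to contain
`x`; its index `k` is determined by where `x` enters the chain. In that apartment the line of `x`
has the direction `coordinateVector n k`. The defining formula of `lineAngle` does not mention the
chain, so these local angles agree on common faces. -/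
theorem lineAngle_eq {x : FTwoSpace n} {y : Building n} {k : ℕ} (hk : k < n - 1)
    (h : ∀ U ∈ y.weight.support, x ∈ U.1 ↔ k < U.rank) :
    lineAngle x y = InnerProductGeometry.angle (coordinateVector n k) (chart y) := by
  unfold lineAngle InnerProductGeometry.angle
  rw [norm_coordinateVector hk]
  congr 2
  unfold chart Finsupp.sum
  rw [inner_sum]
  refine Finset.sum_congr rfl fun U hU => ?_
  rw [real_inner_smul_right, inner_coordinateVector U.rank_lt.le hk]
  simp only [h U hU]

theorem exists_coordinate (x : FTwoSpace n) {σ : Finset (BuildingVertex n)}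
    (hσ : σ ∈ (buildingComplex n).faces) :
    ∃ k < n - 1, ∀ U ∈ σ, x ∈ U.1 ↔ k < U.rank := by
  classical
  by_cases hx : ∃ U ∈ σ, x ∈ U.1
  · obtain ⟨U₀, hU₀, hmin⟩ := (σ.filter fun U => x ∈ U.1).exists_min_image BuildingVertex.rank
      (by obtain ⟨U, hU, hxU⟩ := hx; exact ⟨U, Finset.mem_filter.mpr ⟨hU, hxU⟩⟩)
    rw [Finset.mem_filter] at hU₀
    have h1 := U₀.rank_lt
    have h2 := U₀.rank_pos
    refine ⟨U₀.rank - 1, by omega, fun U hU => ⟨fun hxU => ?_, fun hlt => ?_⟩⟩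
    · have := hmin U (Finset.mem_filter.mpr ⟨hU, hxU⟩)
      omega
    · rcases eq_or_ne U₀ U with rfl | hne
      · exact hU₀.2
      · rcases hσ.2 hU₀.1 hU hne with hle | hle
        · exact hle hU₀.2
        · have := BuildingVertex.rank_lt_rank (lt_of_le_of_ne hle hne.symm)
          omega
  · push Not at hx
    obtain ⟨U, hU⟩ := hσ.1
    have := U.rank_lt
    -- When `x` lies in no member of the chain, it enters only at the whole space, of rank `n - 1`.
    refine ⟨n - 2, by omega, fun U hU => ⟨fun h => (hx U hU h).elim, fun h => ?_⟩⟩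
    have := U.rank_lt
    omega

/-- Over one closed simplex both values are angles to the same vector, so this is the triangle
inequality for angles. Summed along broken paths, it gives the lower bound for the length metric. -/
theorem abs_lineAngle_sub_le_simplexDist (x : FTwoSpace n) {y z : Building n}
    (h : InCommonSimplex y z) : |lineAngle x y - lineAngle x z| ≤ simplexDist y z := by
  obtain ⟨σ, hσ, hy, hz⟩ := h
  obtain ⟨k, hk, hkσ⟩ := exists_coordinate x hσ
  rw [lineAngle_eq hk fun U hU => hkσ U (hy hU), lineAngle_eq hk fun U hU => hkσ U (hz hU),
    abs_sub_le_iff]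
  unfold simplexDist
  have h1 := InnerProductGeometry.angle_le_angle_add_angle (coordinateVector n k) (chart y)
    (chart z)
  have h2 := InnerProductGeometry.angle_le_angle_add_angle (coordinateVector n k) (chart z)
    (chart y)
  rw [InnerProductGeometry.angle_comm (chart z) (chart y)] at h2
  constructor <;> linarith

theorem ofReal_abs_lineAngle_sub_le_edist (x : FTwoSpace n) (y z : Building n) :
    ENNReal.ofReal |lineAngle x y - lineAngle x z| ≤ edist y z := by
  refine le_sInf fun l hl => ?_
  induction hl with
  | refl y => simp
  | @step y w z l hyw _ ih =>
    calc ENNReal.ofReal |lineAngle x y - lineAngle x z|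
        ≤ ENNReal.ofReal (|lineAngle x y - lineAngle x w| + |lineAngle x w - lineAngle x z|) :=
          ENNReal.ofReal_le_ofReal (abs_sub_le _ _ _)
      _ = ENNReal.ofReal |lineAngle x y - lineAngle x w|
          + ENNReal.ofReal |lineAngle x w - lineAngle x z| :=
          ENNReal.ofReal_add (abs_nonneg _) (abs_nonneg _)
      _ ≤ _ := add_le_add (ENNReal.ofReal_le_ofReal (abs_lineAngle_sub_le_simplexDist x hyw)) ih

theorem edist_le_simplexDist {y z : Building n} (h : InCommonSimplex y z) :
    edist y z ≤ ENNReal.ofReal (simplexDist y z) := by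
  refine sInf_le ?_
  have := HasBrokenPath.step h (HasBrokenPath.refl z)
  rwa [add_zero] at this

/-! ## Points of edges -/

theorem ext_weight {y z : Building n} (h : y.weight = z.weight) : y = z := by
  cases y
  cases z
  cases h
  rfl

theorem edge_comm (U U' : BuildingVertex n) : edge U U' = edge U' U := by
  ext y
  simp only [edge, Set.mem_ofPred_eq, or_comm]

theorem sum_weight_edge {M : Type*} [AddCommMonoid M] {U U' : BuildingVertex n} (hne : U ≠ U')
    {y : Building n} (hy : y ∈ edge U U') (f : BuildingVertex n → ℝ → M) (hf : ∀ V, f V 0 = 0) :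
    y.weight.sum f = f U (y.weight U) + f U' (y.weight U') := by
  classical
  rw [Finsupp.sum_of_support_subset (s := {U, U'}) y.weight
    (fun V hV => by simpa using hy V hV) f fun V _ => hf V, Finset.sum_pair hne]

theorem weight_add_weight_edge {U U' : BuildingVertex n} (hne : U ≠ U') {y : Building n}
    (hy : y ∈ edge U U') : y.weight U + y.weight U' = 1 := by
  rw [← y.sum_weight, sum_weight_edge hne hy _ fun _ => rfl]

theorem chart_edge {U U' : BuildingVertex n} (hne : U ≠ U') {y : Building n}
    (hy : y ∈ edge U U') : chart y = y.weight U • chamberVector n U.rank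
      + y.weight U' • chamberVector n U'.rank :=
  sum_weight_edge hne hy _ fun _ => zero_smul _ _

theorem eq_of_weight_eq_edge {U U' : BuildingVertex n} (hne : U ≠ U') {y z : Building n}
    (hy : y ∈ edge U U') (hz : z ∈ edge U U') (h : y.weight U' = z.weight U') : y = z := by
  refine ext_weight (Finsupp.ext fun V => ?_)
  have h1 := weight_add_weight_edge hne hy
  have h2 := weight_add_weight_edge hne hz
  by_cases hV : V = U ∨ V = U'
  · rcases hV with rfl | rfl
    · linarith
    · exact h
  · rw [Finsupp.notMem_support_iff.mp fun h' => hV (hy V h'),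
      Finsupp.notMem_support_iff.mp fun h' => hV (hz V h')]

theorem ofVertex_mem_edge_left (U U' : BuildingVertex n) : ofVertex U ∈ edge U U' := by
  intro V hV
  exact .inl (by simpa using Finsupp.support_single_subset hV)

theorem ofVertex_mem_edge_right (U U' : BuildingVertex n) : ofVertex U' ∈ edge U U' := by
  rw [edge_comm]
  exact ofVertex_mem_edge_left U' U

theorem _root_.BuildingVertex.Adjacent.ne {U U' : BuildingVertex n} (h : U.Adjacent U') :
    U ≠ U' := by
  rcases h with h | h
  · exact h.ne
  · exact h.ne'

theorem _root_.BuildingVertex.Adjacent.symm {U U' : BuildingVertex n} (h : U.Adjacent U') :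
    U'.Adjacent U :=
  Or.symm h

theorem pair_mem_faces [DecidableEq (BuildingVertex n)] {U U' : BuildingVertex n}
    (h : U.Adjacent U') : ({U, U'} : Finset (BuildingVertex n)) ∈ (buildingComplex n).faces := by
  refine ⟨Finset.insert_nonempty _ _, ?_⟩
  rw [Finset.coe_pair]
  rcases h with h | h
  · exact IsChain.pair h.le
  · rw [Set.pair_comm]
    exact IsChain.pair h.le

theorem inCommonSimplex_edge {U U' : BuildingVertex n} (h : U.Adjacent U') {y z : Building n}
    (hy : y ∈ edge U U') (hz : z ∈ edge U U') : InCommonSimplex y z := by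
  classical
  exact ⟨{U, U'}, pair_mem_faces h, fun V hV => by simpa using hy V hV,
    fun V hV => by simpa using hz V hV⟩

theorem eq_zero_of_smul_chamberVector_edge {U U' : BuildingVertex n} (h : U.Adjacent U') {s t : ℝ}
    (hst : s • chamberVector n U.rank + t • chamberVector n U'.rank = 0) : s = 0 ∧ t = 0 := by
  rcases h with h | h
  · exact eq_zero_of_smul_chamberVector_add U.rank_pos (BuildingVertex.rank_lt_rank h)
      U'.rank_lt hst
  · rw [add_comm] at hst
    exact (eq_zero_of_smul_chamberVector_add U'.rank_pos (BuildingVertex.rank_lt_rank h)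
      U.rank_lt hst).symm

theorem chart_edge_ne_zero {U U' : BuildingVertex n} (h : U.Adjacent U') {y : Building n}
    (hy : y ∈ edge U U') : chart y ≠ 0 := by
  intro h0
  rw [chart_edge h.ne hy] at h0
  have h1 := weight_add_weight_edge h.ne hy
  obtain ⟨h2, h3⟩ := eq_zero_of_smul_chamberVector_edge h h0
  rw [h2, h3] at h1
  norm_num at h1

theorem exists_mem_edge_weight_eq {U U' : BuildingVertex n} (h : U.Adjacent U') {c : ℝ}
    (hc0 : 0 ≤ c) (hc1 : c ≤ 1) : ∃ y ∈ edge U U', y.weight U = 1 - c ∧ y.weight U' = c := by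
  classical
  let w : BuildingVertex n →₀ ℝ := Finsupp.single U (1 - c) + Finsupp.single U' c
  have hsupp : w.support ⊆ {U, U'} := fun V hV => by
    by_contra hV'
    simp only [Finset.mem_insert, Finset.mem_singleton, not_or] at hV'
    rw [Finsupp.mem_support_iff] at hV
    exact hV (by simp [w, Finsupp.single_eq_of_ne hV'.1, Finsupp.single_eq_of_ne hV'.2])
  have hsum : (w.sum fun _ c => c) = 1 := by
    rw [Finsupp.sum_add_index' (fun _ => rfl) (fun _ _ _ => rfl), Finsupp.sum_single_index rfl,
      Finsupp.sum_single_index rfl]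
    ring
  have hne : w.support.Nonempty := by
    rw [Finset.nonempty_iff_ne_empty]
    intro h0
    rw [Finsupp.support_eq_empty.mp h0, Finsupp.sum_zero_index] at hsum
    exact zero_ne_one hsum
  refine ⟨⟨w, fun V => ?_, ?_, hsum⟩, fun V hV => by simpa using hsupp hV, ?_, ?_⟩
  · rw [Finsupp.add_apply, Finsupp.single_apply, Finsupp.single_apply]
    split_ifs <;> linarith
  · exact ((buildingComplex n).isRelLowerSet_faces (pair_mem_faces h)).2 hsupp hne
  · simp [w, Finsupp.single_eq_of_ne h.ne]
  · simp [w, Finsupp.single_eq_of_ne h.ne.symm]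
/-! ## Edges on great circles through a vertex of rank one -/

/-- The great circle through the edge from `U` to `U'` contains the vertex spanned by `x` (in an
apartment with the three of them), and the edge leads away from that vertex. -/
def IsRadialEdge (x : FTwoSpace n) (U U' : BuildingVertex n) : Prop :=
  U.Adjacent U' ∧ ∃ (k : ℕ) (r t : ℝ), k < n - 1 ∧ (x ∈ U.1 ↔ k < U.rank) ∧
    (x ∈ U'.1 ↔ k < U'.rank) ∧ 0 ≤ r ∧ 0 ≤ t ∧ 0 < r + t ∧
    coordinateVector n k = r • chamberVector n U.rank - t • chamberVector n U'.rank

theorem lineAngle_edge {x : FTwoSpace n} {U U' : BuildingVertex n} {k : ℕ} (hk : k < n - 1)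
    (hU : x ∈ U.1 ↔ k < U.rank) (hU' : x ∈ U'.1 ↔ k < U'.rank) {y : Building n}
    (hy : y ∈ edge U U') :
    lineAngle x y = InnerProductGeometry.angle (coordinateVector n k) (chart y) := by
  refine lineAngle_eq hk fun V hV => ?_
  rcases hy V hV with rfl | rfl
  · exact hU
  · exact hU'

/-- The angle is additive if the middle vector is a non-negative combination of the others. -/
theorem angle_eq_angle_add_angle_of_smul_eq {E : Type*} [NormedAddCommGroup E]
    [InnerProductSpace ℝ E] {u v w : E} (hv : v ≠ 0) {a b c : ℝ} (ha : 0 < a) (hb : 0 ≤ b)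
    (hc : 0 ≤ c) (h : a • v = b • u + c • w) :
    InnerProductGeometry.angle u w
      = InnerProductGeometry.angle u v + InnerProductGeometry.angle v w := by
  refine InnerProductGeometry.angle_eq_angle_add_add_angle_add_of_mem_span hv ?_
  rw [Submodule.mem_span_pair]
  refine ⟨(b / a).toNNReal, (c / a).toNNReal, ?_⟩
  rw [NNReal.smul_def, NNReal.smul_def, Real.coe_toNNReal _ (div_nonneg hb ha.le),
    Real.coe_toNNReal _ (div_nonneg hc ha.le)]
  rw [div_eq_inv_mul, div_eq_inv_mul, mul_smul, mul_smul, ← smul_add, ← h, inv_smul_smul₀ ha.ne']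

namespace IsRadialEdge

variable {x : FTwoSpace n} {U U' : BuildingVertex n}

/-- The relation defining a radial edge places `chart y` in the cone spanned by the direction of `x`
and `chart z`, so angles add up along the edge. -/
theorem lineAngle_add (h : IsRadialEdge x U U') {y z : Building n} (hy : y ∈ edge U U')
    (hz : z ∈ edge U U') (hyz : y.weight U' < z.weight U') :
    lineAngle x z = lineAngle x y + simplexDist y z := by
  obtain ⟨hadj, k, r, t, hk, hU, hU', hr, ht, hrt, hu⟩ := h
  rw [lineAngle_edge hk hU hU' hy, lineAngle_edge hk hU hU' hz]
  have hy1 := weight_add_weight_edge hadj.ne hy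
  have hz1 := weight_add_weight_edge hadj.ne hz
  have hyU := y.weight_nonneg U
  have hyU' := y.weight_nonneg U'
  have hzU := z.weight_nonneg U
  have hzU' := z.weight_nonneg U'
  have hcy := chart_edge hadj.ne hy
  have hcz := chart_edge hadj.ne hz
  have hy0 := chart_edge_ne_zero hadj hy
  unfold simplexDist
  have hD : 0 ≤ r * z.weight U' + t * z.weight U := by positivity
  -- The coefficient of `chart y` in the cone relation vanishes only when `z` is the vertex `U'` and
  -- is antipodal to `x`; there the angles add up to `π` for a different reason.
  rcases hD.eq_or_lt with hD | hD
  · have hzpos : 0 < z.weight U' := by linarith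
    have hr0 : r = 0 := by
      have h1 : r * z.weight U' = 0 := by
        have := mul_nonneg hr hzpos.le
        have := mul_nonneg ht hzU
        linarith
      exact (mul_eq_zero.mp h1).resolve_right hzpos.ne'
    have ht0 : 0 < t := by linarith
    have hzU0 : z.weight U = 0 := by
      rw [hr0, zero_mul, zero_add] at hD
      exact (mul_eq_zero.mp hD.symm).resolve_left ht0.ne'
    have hz1' : z.weight U' = 1 := by linarith
    rw [hzU0, hz1', zero_smul, zero_add, one_smul] at hcz
    rw [hr0, zero_smul, zero_sub, ← hcz] at hu
    have hpi : InnerProductGeometry.angle (chart z) (coordinateVector n k) = Real.pi := by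
      rw [InnerProductGeometry.angle_eq_pi_iff]
      exact ⟨chart_edge_ne_zero hadj hz, -t, by linarith, by rw [hu, neg_smul]⟩
    have h1 := InnerProductGeometry.angle_add_angle_eq_pi_of_angle_eq_pi (chart y) hpi
    rw [InnerProductGeometry.angle_comm _ (chart z), hpi, ← h1,
      InnerProductGeometry.angle_comm _ (chart y), add_comm]
  · refine angle_eq_angle_add_angle_of_smul_eq hy0 hD (b := z.weight U' - y.weight U')
      (c := r * y.weight U' + t * y.weight U) (by linarith) (by positivity) ?_
    have hyU1 : y.weight U = 1 - y.weight U' := by linarith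
    have hzU1 : z.weight U = 1 - z.weight U' := by linarith
    rw [hcy, hcz, hu, hyU1, hzU1]
    module

theorem lineAngle_lt (h : IsRadialEdge x U U') {y z : Building n} (hy : y ∈ edge U U')
    (hz : z ∈ edge U U') (hyz : y.weight U' < z.weight U') : lineAngle x y < lineAngle x z := by
  rw [h.lineAngle_add hy hz hyz, lt_add_iff_pos_right]
  refine (InnerProductGeometry.angle_nonneg _ _).lt_of_ne' fun h0 => ?_
  obtain ⟨-, ρ, -, hρ⟩ := InnerProductGeometry.angle_eq_zero_iff.mp h0
  rw [chart_edge h.1.ne hy, chart_edge h.1.ne hz] at hρ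
  have h1 := eq_zero_of_smul_chamberVector_edge h.1 (s := z.weight U - ρ * y.weight U)
    (t := z.weight U' - ρ * y.weight U') (by
      rw [sub_smul, sub_smul, mul_smul, mul_smul, sub_add_sub_comm, hρ, ← smul_add, sub_self])
  have hy1 := weight_add_weight_edge h.1.ne hy
  have hz1 := weight_add_weight_edge h.1.ne hz
  -- Proportional charts on an edge give proportional weights, and both pairs of weights sum to one.
  have hρ1 : ρ = 1 := by
    have : ρ * (y.weight U + y.weight U') = 1 := by linarith
    rwa [hy1, mul_one] at this
  rw [hρ1, one_mul] at h1
  linarith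

theorem lineAngle_injOn (h : IsRadialEdge x U U') : Set.InjOn (lineAngle x) (edge U U') := by
  intro y hy z hz hyz
  rcases lt_trichotomy (y.weight U') (z.weight U') with h1 | h1 | h1
  · exact absurd hyz (h.lineAngle_lt hy hz h1).ne
  · exact eq_of_weight_eq_edge h.1.ne hy hz h1
  · exact absurd hyz (h.lineAngle_lt hz hy h1).ne'

theorem edist_le (h : IsRadialEdge x U U') {y z : Building n} (hy : y ∈ edge U U')
    (hz : z ∈ edge U U') : edist y z ≤ ENNReal.ofReal |lineAngle x y - lineAngle x z| := by
  rcases lt_trichotomy (y.weight U') (z.weight U') with h1 | h1 | h1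
  · refine (edist_le_simplexDist (inCommonSimplex_edge h.1 hy hz)).trans
      (ENNReal.ofReal_le_ofReal ?_)
    rw [h.lineAngle_add hy hz h1, abs_sub_comm]
    exact (add_sub_cancel_left _ _).ge.trans (le_abs_self _)
  · rw [eq_of_weight_eq_edge h.1.ne hy hz h1, edist_self]
    exact bot_le
  · rw [edist_comm]
    refine (edist_le_simplexDist (inCommonSimplex_edge h.1 hz hy)).trans
      (ENNReal.ofReal_le_ofReal ?_)
    rw [h.lineAngle_add hz hy h1]
    exact (add_sub_cancel_left _ _).ge.trans (le_abs_self _)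

theorem lineAngle_lt_vertex (h : IsRadialEdge x U U') :
    lineAngle x (ofVertex U) < lineAngle x (ofVertex U') := by
  refine h.lineAngle_lt (ofVertex_mem_edge_left _ _) (ofVertex_mem_edge_right _ _) ?_
  simp [ofVertex, Finsupp.single_eq_of_ne h.1.ne.symm]

theorem lineAngle_mem_Icc (h : IsRadialEdge x U U') {y : Building n} (hy : y ∈ edge U U') :
    lineAngle x y ∈ Set.Icc (lineAngle x (ofVertex U)) (lineAngle x (ofVertex U')) := by
  have hU := ofVertex_mem_edge_left U U'
  have hU' := ofVertex_mem_edge_right U U'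
  have hw : (ofVertex U).weight U' = 0 := by simp [ofVertex, Finsupp.single_eq_of_ne h.1.ne.symm]
  have hw' : (ofVertex U').weight U' = 1 := by simp [ofVertex]
  have h1 := weight_add_weight_edge h.1.ne hy
  constructor
  · rcases (y.weight_nonneg U').eq_or_lt with h0 | h0
    · rw [eq_of_weight_eq_edge h.1.ne hy hU (by rw [hw, h0])]
    · exact (h.lineAngle_lt hU hy (by rwa [hw])).le
  · rcases (y.weight_nonneg U).eq_or_lt with h0 | h0
    · rw [eq_of_weight_eq_edge h.1.ne hy hU' (by rw [hw']; linarith)]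
    · exact (h.lineAngle_lt hy hU' (by rw [hw']; linarith)).le

theorem lineAngle_surjOn (h : IsRadialEdge x U U') : Set.SurjOn (lineAngle x) (edge U U')
    (Set.Icc (lineAngle x (ofVertex U)) (lineAngle x (ofVertex U'))) := by
  obtain ⟨k, r, t, hk, hU, hU', -⟩ := h.2
  let f : ℝ → ℝ := fun c => InnerProductGeometry.angle (coordinateVector n k)
    ((1 - c) • chamberVector n U.rank + c • chamberVector n U'.rank)
  have hcoord : coordinateVector n k ≠ 0 := by
    have h1 := U.rank_pos
    have h2 := U'.rank_pos
    have h3 := U.rank_lt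
    have h4 := U'.rank_lt
    have h5 : U.rank ≠ U'.rank := by
      rcases h.1 with h | h
      · exact (BuildingVertex.rank_lt_rank h).ne
      · exact (BuildingVertex.rank_lt_rank h).ne'
    rw [← norm_ne_zero_iff, norm_coordinateVector hk, Real.sqrt_ne_zero', sub_pos,
      div_lt_one (by exact_mod_cast (by omega : 0 < n - 1))]
    exact_mod_cast (by omega : 1 < n - 1)
  have hf : ContinuousOn f (Set.Icc 0 1) := by
    intro c _
    refine ContinuousAt.continuousWithinAt ?_
    have h1 := InnerProductGeometry.continuousAt_angle (x := (coordinateVector n k,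
      (1 - c) • chamberVector n U.rank + c • chamberVector n U'.rank)) hcoord (by
        intro h0
        obtain ⟨h1, h2⟩ := eq_zero_of_smul_chamberVector_edge h.1 h0
        linarith)
    exact h1.comp (f := fun c : ℝ => (coordinateVector n k,
      (1 - c) • chamberVector n U.rank + c • chamberVector n U'.rank)) (by fun_prop)
  have hval : ∀ y ∈ edge U U', lineAngle x y = f (y.weight U') := fun y hy => by
    have h1 := weight_add_weight_edge h.1.ne hy
    rw [lineAngle_edge hk hU hU' hy, chart_edge h.1.ne hy, eq_sub_iff_add_eq.mpr h1]
  have hw : (ofVertex U).weight U' = 0 := by simp [ofVertex, Finsupp.single_eq_of_ne h.1.ne.symm]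
  have hw' : (ofVertex U').weight U' = 1 := by simp [ofVertex]
  rw [hval _ (ofVertex_mem_edge_left _ _), hval _ (ofVertex_mem_edge_right _ _), hw, hw']
  intro s hs
  obtain ⟨c, hc, rfl⟩ := intermediate_value_Icc zero_le_one hf hs
  obtain ⟨y, hy, -, hyc⟩ := exists_mem_edge_weight_eq h.1 hc.1 hc.2
  exact ⟨y, hy, by rw [hval y hy, hyc]⟩

theorem image_lineAngle (h : IsRadialEdge x U U') : lineAngle x '' edge U U'
    = Set.Icc (lineAngle x (ofVertex U)) (lineAngle x (ofVertex U')) :=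
  Set.Subset.antisymm (Set.image_subset_iff.mpr fun _ hy => h.lineAngle_mem_Icc hy)
    h.lineAngle_surjOn

end IsRadialEdge

/-! ## Geodesics that consist of three edges -/

/-- The map `γ` is a geodesic of length `π` that runs through the edges from `p₀` to `p₁`, from
`p₁` to `p₂` and from `p₂` to `p₃`, with the vertices `p₁` and `p₂` at the times `a` and `b`. -/
structure IsThreeEdgeGeodesic (γ : ℝ → Building n) (p₀ p₁ p₂ p₃ : BuildingVertex n) (a b : ℝ) :
    Prop where
  isGeodesic : IsGeodesic γ Real.pi
  pos : 0 < a
  lt : a < b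
  lt_pi : b < Real.pi
  map_zero : γ 0 = ofVertex p₀
  map_left : γ a = ofVertex p₁
  map_right : γ b = ofVertex p₂
  map_pi : γ Real.pi = ofVertex p₃
  image_first : γ '' Set.Icc 0 a = edge p₀ p₁
  image_second : γ '' Set.Icc a b = edge p₁ p₂
  image_third : γ '' Set.Icc b Real.pi = edge p₂ p₃

theorem IsThreeEdgeGeodesic.reverse {γ : ℝ → Building n} {p₀ p₁ p₂ p₃ : BuildingVertex n}
    {a b : ℝ} (h : IsThreeEdgeGeodesic γ p₀ p₁ p₂ p₃ a b) :
    IsThreeEdgeGeodesic (fun s => γ (Real.pi - s)) p₃ p₂ p₁ p₀ (Real.pi - b) (Real.pi - a) := by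
  have himage : ∀ s t, (fun r => γ (Real.pi - r)) '' Set.Icc s t
      = γ '' Set.Icc (Real.pi - t) (Real.pi - s) := fun s t => by
    rw [← Set.image_const_sub_Icc, Set.image_image]
  refine ⟨fun s t => ?_, by linarith [h.lt_pi], by linarith [h.lt], by linarith [h.pos], ?_, ?_,
    ?_, ?_, ?_, ?_, ?_⟩
  · have hmem : ∀ r : Set.Icc (0 : ℝ) Real.pi, Real.pi - (r : ℝ) ∈ Set.Icc (0 : ℝ) Real.pi :=
      fun r => ⟨by linarith [r.2.2], by linarith [r.2.1]⟩
    have h1 := h.isGeodesic ⟨_, hmem s⟩ ⟨_, hmem t⟩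
    rw [Set.domRestrict_apply, Set.domRestrict_apply] at h1 ⊢
    rw [h1, Subtype.edist_eq, Subtype.edist_eq]
    exact edist_sub_left _ _ _
  · simpa using h.map_pi
  · simpa using h.map_right
  · simpa using h.map_left
  · simpa using h.map_zero
  · rw [himage, sub_sub_cancel, sub_zero, h.image_third, edge_comm]
  · rw [himage, sub_sub_cancel, sub_sub_cancel, h.image_second, edge_comm]
  · rw [himage, sub_sub_cancel, sub_self, h.image_first, edge_comm]

/-- On the union `K` of the edges the function `F` is a bijection onto `[0, π]`. Distances in `K`
are at most the differences of `F`, by concatenation through the common vertices, and at least these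
differences, because `F` is 1-Lipschitz. -/
theorem exists_isThreeEdgeGeodesic_of_isRadialEdge {x : FTwoSpace n}
    {p₀ p₁ p₂ p₃ : BuildingVertex n} (h₁ : IsRadialEdge x p₀ p₁) (h₂ : IsRadialEdge x p₁ p₂)
    (h₃ : IsRadialEdge x p₂ p₃) (hzero : lineAngle x (ofVertex p₀) = 0)
    (hpi : lineAngle x (ofVertex p₃) = Real.pi) :
    ∃ γ a b, IsThreeEdgeGeodesic γ p₀ p₁ p₂ p₃ a b := by
  set F := lineAngle x with hF
  set a := F (ofVertex p₁) with ha
  set b := F (ofVertex p₂) with hb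
  have h0a : 0 < a := hzero ▸ h₁.lineAngle_lt_vertex
  have hab : a < b := h₂.lineAngle_lt_vertex
  have hbpi : b < Real.pi := hpi ▸ h₃.lineAngle_lt_vertex
  let K : Set (Building n) := edge p₀ p₁ ∪ edge p₁ p₂ ∪ edge p₂ p₃
  have hI₁ : F '' edge p₀ p₁ = Set.Icc 0 a := by rw [h₁.image_lineAngle, ← hF, hzero]
  have hI₂ : F '' edge p₁ p₂ = Set.Icc a b := h₂.image_lineAngle
  have hI₃ : F '' edge p₂ p₃ = Set.Icc b Real.pi := by rw [h₃.image_lineAngle, ← hF, hpi]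
  have hIK : F '' K = Set.Icc 0 Real.pi := by
    rw [Set.image_union, Set.image_union, hI₁, hI₂, hI₃, Set.Icc_union_Icc_eq_Icc h0a.le hab.le,
      Set.Icc_union_Icc_eq_Icc (h0a.trans hab).le hbpi.le]
  have hle : ∀ y ∈ K, ∀ z ∈ K, F y ≤ F z → edist y z ≤ ENNReal.ofReal (F z - F y) := by
    have hsame : ∀ {U U' : BuildingVertex n}, IsRadialEdge x U U' → ∀ y ∈ edge U U',
        ∀ z ∈ edge U U', F y ≤ F z → edist y z ≤ ENNReal.ofReal (F z - F y) := by
      intro U U' h y hy z hz hyz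
      have := h.edist_le hy hz
      rwa [abs_sub_comm, abs_of_nonneg (sub_nonneg.mpr hyz)] at this
    have htrans : ∀ y z w : Building n, F y ≤ F w → F w ≤ F z →
        edist y w ≤ ENNReal.ofReal (F w - F y) → edist w z ≤ ENNReal.ofReal (F z - F w) →
        edist y z ≤ ENNReal.ofReal (F z - F y) := by
      intro y z w hyw hwz h1 h2
      refine (edist_triangle y w z).trans ((add_le_add h1 h2).trans ?_)
      rw [← ENNReal.ofReal_add (by linarith) (by linarith)]
      exact ENNReal.ofReal_le_ofReal (by linarith)
    have l₁ := ofVertex_mem_edge_right p₀ p₁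
    have l₂ := ofVertex_mem_edge_left p₁ p₂
    have l₃ := ofVertex_mem_edge_right p₁ p₂
    have l₄ := ofVertex_mem_edge_left p₂ p₃
    have b₁ : ∀ y ∈ edge p₀ p₁, F y ≤ a := fun y hy => (h₁.lineAngle_mem_Icc hy).2
    have b₂ : ∀ y ∈ edge p₁ p₂, a ≤ F y ∧ F y ≤ b := fun y hy => h₂.lineAngle_mem_Icc hy
    have b₃ : ∀ y ∈ edge p₂ p₃, b ≤ F y := fun y hy => (h₃.lineAngle_mem_Icc hy).1
    have h12 : ∀ y ∈ edge p₀ p₁, ∀ z ∈ edge p₁ p₂, edist y z ≤ ENNReal.ofReal (F z - F y) :=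
      fun y hy z hz => htrans y z (ofVertex p₁) (b₁ y hy) (b₂ z hz).1
        (hsame h₁ y hy _ l₁ (b₁ y hy)) (hsame h₂ _ l₂ z hz (b₂ z hz).1)
    have h23 : ∀ y ∈ edge p₁ p₂, ∀ z ∈ edge p₂ p₃, edist y z ≤ ENNReal.ofReal (F z - F y) :=
      fun y hy z hz => htrans y z (ofVertex p₂) (b₂ y hy).2 (b₃ z hz)
        (hsame h₂ y hy _ l₃ (b₂ y hy).2) (hsame h₃ _ l₄ z hz (b₃ z hz))
    have h13 : ∀ y ∈ edge p₀ p₁, ∀ z ∈ edge p₂ p₃, edist y z ≤ ENNReal.ofReal (F z - F y) :=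
      fun y hy z hz => htrans y z (ofVertex p₂) ((b₁ y hy).trans hab.le) (b₃ z hz)
        (h12 y hy _ l₃) (hsame h₃ _ l₄ z hz (b₃ z hz))
    have hswap : ∀ y z : Building n, F y ≤ F z → F z ≤ F y →
        edist z y ≤ ENNReal.ofReal (F y - F z) → edist y z ≤ ENNReal.ofReal (F z - F y) := by
      intro y z h1 h2 h3
      rw [edist_comm]
      exact h3.trans (ENNReal.ofReal_le_ofReal (by linarith))
    rintro y ((hy | hy) | hy) z ((hz | hz) | hz) hyz
    · exact hsame h₁ y hy z hz hyz
    · exact h12 y hy z hz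
    · exact h13 y hy z hz
    · exact hswap y z hyz ((b₁ z hz).trans (b₂ y hy).1) (h12 z hz y hy)
    · exact hsame h₂ y hy z hz hyz
    · exact h23 y hy z hz
    · exact hswap y z hyz ((b₁ z hz).trans (hab.le.trans (b₃ y hy))) (h13 z hz y hy)
    · exact hswap y z hyz ((b₂ z hz).2.trans (b₃ y hy)) (h23 z hz y hy)
    · exact hsame h₃ y hy z hz hyz
  have hinj : Set.InjOn F K := by
    have hcross : ∀ {U V W : BuildingVertex n}, IsRadialEdge x U V → IsRadialEdge x V W →
        ∀ y ∈ edge U V, ∀ z ∈ edge V W, F y = F z → y = z := by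
      intro U V W h h' y hy z hz hyz
      have h1 := (h.lineAngle_mem_Icc hy).2
      have h2 := (h'.lineAngle_mem_Icc hz).1
      rw [h.lineAngle_injOn hy (ofVertex_mem_edge_right U V) (by linarith),
        h'.lineAngle_injOn hz (ofVertex_mem_edge_left V W) (by linarith)]
    have hfar : ∀ y ∈ edge p₀ p₁, ∀ z ∈ edge p₂ p₃, F y ≠ F z := fun y hy z hz =>
      (((h₁.lineAngle_mem_Icc hy).2.trans_lt hab).trans_le (h₃.lineAngle_mem_Icc hz).1).ne
    rintro y ((hy | hy) | hy) z ((hz | hz) | hz) hyz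
    · exact h₁.lineAngle_injOn hy hz hyz
    · exact hcross h₁ h₂ y hy z hz hyz
    · exact (hfar y hy z hz hyz).elim
    · exact (hcross h₁ h₂ z hz y hy hyz.symm).symm
    · exact h₂.lineAngle_injOn hy hz hyz
    · exact hcross h₂ h₃ y hy z hz hyz
    · exact (hfar z hz y hy hyz.symm).elim
    · exact (hcross h₂ h₃ z hz y hy hyz.symm).symm
    · exact h₃.lineAngle_injOn hy hz hyz
  have : Nonempty (Building n) := ⟨ofVertex p₀⟩
  -- Outside `[0, π]` the values of this inverse are arbitrary and play no role.
  let γ : ℝ → Building n := Function.invFunOn F K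
  have hγmem : ∀ s ∈ Set.Icc 0 Real.pi, γ s ∈ K := fun s hs =>
    Function.invFunOn_mem (by rw [← hIK] at hs; exact hs)
  have hFγ : ∀ s ∈ Set.Icc 0 Real.pi, F (γ s) = s := fun s hs =>
    Function.invFunOn_eq (by rw [← hIK] at hs; exact hs)
  have hγF : ∀ y ∈ K, γ (F y) = y := fun y hy => hinj.leftInvOn_invFunOn hy
  have himage : ∀ S ⊆ K, γ '' (F '' S) = S := fun S hS => by
    rw [Set.image_image, Set.image_congr fun y hy => hγF y (hS hy), Set.image_id']
  have hS₁ : edge p₀ p₁ ⊆ K := fun y hy => .inl (.inl hy)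
  have hS₂ : edge p₁ p₂ ⊆ K := fun y hy => .inl (.inr hy)
  have hS₃ : edge p₂ p₃ ⊆ K := fun y hy => .inr hy
  refine ⟨γ, a, b, fun s t => ?_, h0a, hab, hbpi, ?_, ?_, ?_, ?_, ?_, ?_, ?_⟩
  · rw [Set.domRestrict_apply, Set.domRestrict_apply, Subtype.edist_eq, edist_dist, Real.dist_eq]
    apply le_antisymm
    · rcases le_total (s : ℝ) t with hst | hst
      · have := hle _ (hγmem s s.2) _ (hγmem t t.2) (by rwa [hFγ s s.2, hFγ t t.2])
        rwa [hFγ s s.2, hFγ t t.2, ← abs_of_nonneg (sub_nonneg.mpr hst), abs_sub_comm] at this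
      · have := hle _ (hγmem t t.2) _ (hγmem s s.2) (by rwa [hFγ s s.2, hFγ t t.2])
        rwa [hFγ s s.2, hFγ t t.2, ← abs_of_nonneg (sub_nonneg.mpr hst), edist_comm] at this
    · have := ofReal_abs_lineAngle_sub_le_edist x (γ s) (γ t)
      rwa [← hF, hFγ s s.2, hFγ t t.2] at this
  · rw [← hzero]
    exact hγF _ (hS₁ (ofVertex_mem_edge_left _ _))
  · exact hγF _ (hS₂ (ofVertex_mem_edge_left _ _))
  · exact hγF _ (hS₃ (ofVertex_mem_edge_left _ _))
  · rw [← hpi]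
    exact hγF _ (hS₃ (ofVertex_mem_edge_right _ _))
  · rw [← hI₁, himage _ hS₁]
  · rw [← hI₂, himage _ hS₂]
  · rw [← hI₃, himage _ hS₃]

/-- A line `L`, a hyperplane `H` that does not contain it, a subspace `B` of `H` and its join `A`
with `L` are the successive vertices of a geodesic of length `π`. -/
theorem exists_isThreeEdgeGeodesic {x : FTwoSpace n} {L A B H : BuildingVertex n}
    (hL : L.1 = Submodule.span (ZMod 2) {x}) (hA : A.1 = B.1 ⊔ Submodule.span (ZMod 2) {x})
    (hBH : B.1 ≤ H.1) (hxH : x ∉ H.1) (hH : H.rank + 1 = n - 1) :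
    L.Adjacent A ∧ A.Adjacent B ∧ B.Adjacent H ∧ ∃ γ a b, IsThreeEdgeGeodesic γ L A B H a b := by
  have hxB : x ∉ B.1 := fun h => hxH (hBH h)
  have hxL : x ∈ L.1 := hL ▸ Submodule.mem_span_singleton_self x
  have hLA' : L.1 ≤ A.1 := by rw [hL, hA]; exact le_sup_right
  have hBA' : B.1 ≤ A.1 := by rw [hA]; exact le_sup_left
  have hxA : x ∈ A.1 := hLA' hxL
  have hx0 : x ≠ 0 := fun h => hxH (h ▸ H.1.zero_mem)
  have hrL : L.rank = 1 := by
    unfold BuildingVertex.rank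
    rw [hL, finrank_span_singleton hx0]
  have hBA : B < A := lt_of_le_of_ne hBA' fun h => hxB (h ▸ hxA)
  have hrA : A.rank = B.rank + 1 := by
    have h1 := Submodule.finrank_add_le_finrank_add_finrank B.1 (Submodule.span (ZMod 2) {x})
    rw [finrank_span_singleton hx0, ← hA] at h1
    exact le_antisymm h1 (BuildingVertex.rank_lt_rank hBA)
  have hrB := B.rank_pos
  have hrA' := A.rank_lt
  have hBH : B < H := lt_of_le_of_ne hBH fun h => by
    rw [h] at hrA
    omega
  have hLA : L < A := lt_of_le_of_ne hLA' fun h => by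
    rw [h] at hrL
    omega
  have hn : 0 < n - 1 := by omega
  have hu : coordinateVector n 0 = chamberVector n L.rank := by
    rw [coordinateVector, chamberVector_zero, sub_zero, hrL]
  have hu' : coordinateVector n (n - 2) = -chamberVector n H.rank := by
    rw [coordinateVector, show n - 2 + 1 = n - 1 by omega, chamberVector_top hn, zero_sub,
      show H.rank = n - 2 by omega]
  -- The index `k` changes from edge to edge, since `x` enters the chains `L < A`, `B < A` and `B <
  -- H` at the ranks `1`, `B.rank + 1` and `n - 1`. The coordinate vector is accordingly the vector
  -- of `L`, the difference of those of `A` and `B`, and minus that of `H`.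
  have h₁ : IsRadialEdge x L A :=
    ⟨.inl hLA, 0, 1, 0, hn, iff_of_true hxL L.rank_pos, iff_of_true hxA A.rank_pos, zero_le_one,
      le_rfl, by norm_num, by rw [hu, one_smul, zero_smul, sub_zero]⟩
  have h₂ : IsRadialEdge x A B :=
    ⟨.inr hBA, B.rank, 1, 1, B.rank_lt, iff_of_true hxA (by omega), iff_of_false hxB (lt_irrefl _),
      zero_le_one, zero_le_one, by norm_num, by rw [coordinateVector, one_smul, one_smul, hrA]⟩
  have h₃ : IsRadialEdge x B H :=
    ⟨.inl hBH, n - 2, 0, 1, by omega, iff_of_false hxB (by omega), iff_of_false hxH (by omega),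
      le_rfl, zero_le_one, by norm_num, by rw [hu', one_smul, zero_smul, zero_sub]⟩
  have hchart : ∀ U : BuildingVertex n, chart (ofVertex U) = chamberVector n U.rank := fun U => by
    simp [chart, ofVertex]
  refine ⟨.inl hLA, .inr hBA, .inl hBH, exists_isThreeEdgeGeodesic_of_isRadialEdge h₁ h₂ h₃ ?_ ?_⟩
  · rw [lineAngle_edge hn (iff_of_true hxL L.rank_pos) (iff_of_true hxA A.rank_pos)
      (ofVertex_mem_edge_left L A), hu, ← hchart]
    exact InnerProductGeometry.angle_self (chart_edge_ne_zero h₁.1 (ofVertex_mem_edge_left L A))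
  · rw [lineAngle_edge (k := n - 2) (by omega) (iff_of_false hxB (by omega))
      (iff_of_false hxH (by omega)) (ofVertex_mem_edge_right B H), hu', ← hchart]
    exact InnerProductGeometry.angle_neg_self_of_nonzero
      (chart_edge_ne_zero h₃.1 (ofVertex_mem_edge_right B H))

theorem IsThreeEdgeGeodesic.disjoint_ncp {γ : ℝ → Building n} {p₀ p₁ p₂ p₃ : BuildingVertex n}
    {a b : ℝ} (h : IsThreeEdgeGeodesic γ p₀ p₁ p₂ p₃ a b) (h₀ : ¬ p₀.IsNCP) (h₁ : ¬ p₁.IsNCP)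
    (h₂ : ¬ p₂.IsNCP) (h₃ : ¬ p₃.IsNCP) : Disjoint (γ '' Set.Icc 0 Real.pi) (ncp n) := by
  have hedge : ∀ U U' : BuildingVertex n, ¬ U.IsNCP → ¬ U'.IsNCP → Disjoint (edge U U') (ncp n) := by
    intro U U' hU hU'
    rw [Set.disjoint_left]
    rintro y hy ⟨⟨⟨V, hV⟩, -⟩, hncp⟩
    rcases hy V hV with rfl | rfl
    · exact hU (hncp _ hV)
    · exact hU' (hncp _ hV)
  rw [← Set.Icc_union_Icc_eq_Icc (h.pos.trans h.lt).le h.lt_pi.le,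
    ← Set.Icc_union_Icc_eq_Icc h.pos.le h.lt.le, Set.image_union, Set.image_union, h.image_first,
    h.image_second, h.image_third, Set.disjoint_union_left, Set.disjoint_union_left]
  exact ⟨⟨hedge _ _ h₀ h₁, hedge _ _ h₁ h₂⟩, hedge _ _ h₂ h₃⟩

end Building

/-! ### The geodesic through a given vertex -/

theorem mainTheorem10 (n : ℕ) (hn : 5 ≤ n) (p : BuildingVertex n) (hp : ¬ p.IsNCP) :
    ∃ (γ : ℝ → Building n) (p_u q p_v : BuildingVertex n) (a b : ℝ),
      Building.IsGeodesic γ Real.pi ∧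
      Building.ofVertex p ∈ γ '' Set.Icc 0 Real.pi ∧
      Disjoint (γ '' Set.Icc 0 Real.pi) (Building.ncp n) ∧
      p_u.Adjacent p ∧ p.Adjacent q ∧ q.Adjacent p_v ∧
      0 < a ∧ a < b ∧ b < Real.pi ∧
      γ 0 = Building.ofVertex p_u ∧ γ a = Building.ofVertex p ∧
      γ b = Building.ofVertex q ∧ γ Real.pi = Building.ofVertex p_v ∧
      γ '' Set.Icc 0 a = Building.edge p_u p ∧
      γ '' Set.Icc a b = Building.edge p q ∧
      γ '' Set.Icc b Real.pi = Building.edge q p_v := by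
  suffices h : ∃ (p_u q p_v : BuildingVertex n), ¬ p_u.IsNCP ∧ ¬ q.IsNCP ∧ ¬ p_v.IsNCP ∧
      p_u.Adjacent p ∧ p.Adjacent q ∧ q.Adjacent p_v ∧
      ∃ γ a b, Building.IsThreeEdgeGeodesic γ p_u p q p_v a b by
    obtain ⟨p_u, q, p_v, hu, hq, hv, hup, hpq, hqv, γ, a, b, h⟩ := h
    exact ⟨γ, p_u, q, p_v, a, b, h.isGeodesic,
      ⟨a, ⟨h.pos.le, (h.lt.trans h.lt_pi).le⟩, h.map_left⟩, h.disjoint_ncp hu hp hq hv, hup, hpq,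
      hqv, h.pos, h.lt, h.lt_pi, h.map_zero, h.map_left, h.map_right, h.map_pi, h.image_first,
      h.image_second, h.image_third⟩
  obtain ⟨x, g, hx, hg, hgx, hcases⟩ := hasOppositePair_of_not_isNCPSubspace hn (p := p.1) hp
  have hx0 : x ≠ 0 := fun h => hx (h ▸ isEdgeVector_zero (by omega))
  have hg0 : g ≠ 0 := fun h => by
    rw [h, LinearMap.zero_apply] at hgx
    exact zero_ne_one hgx
  have hrank : Module.finrank (ZMod 2) (LinearMap.ker g) + 1 = n - 1 := by
    rw [Module.Dual.finrank_ker_add_one_of_ne_zero (f := g) hg0, Module.finrank_fin_fun]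
  have hxg : x ∉ LinearMap.ker g := fun h => by
    rw [LinearMap.mem_ker, hgx] at h
    exact one_ne_zero h
  let L : BuildingVertex n := ⟨Submodule.span (ZMod 2) {x}, by
    rwa [Ne, Submodule.span_singleton_eq_bot], fun h => by
      have h1 := finrank_span_singleton (K := ZMod 2) hx0
      rw [h, finrank_top, Module.finrank_fin_fun] at h1
      omega⟩
  let H : BuildingVertex n := ⟨LinearMap.ker g, fun h => by
      rw [h, finrank_bot] at hrank
      omega, fun h => hxg (h ▸ Submodule.mem_top)⟩
  have hL : ¬ L.IsNCP := fun ⟨P, _, hP⟩ => partitionSubspace_ne_span hx hx0 P hP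
  have hH : ¬ H.IsNCP := fun ⟨_, hP, hPH⟩ => hP.partitionSubspace_ne_ker hg hPH
  rcases hcases with ⟨hxp, hbot, hq⟩ | ⟨hpg, htop, hq⟩
  · let q : BuildingVertex n := ⟨p.1 ⊓ LinearMap.ker g, hbot,
      fun h => p.2.2 (top_le_iff.mp (h.ge.trans inf_le_left))⟩
    -- Since `g x = 1`, one of `v` and `v + x` lies in `ker g` for every `v` in `p`.
    have hpq : p.1 = q.1 ⊔ Submodule.span (ZMod 2) {x} := by
      refine le_antisymm (fun v hv => ?_)
        (sup_le inf_le_left ((Submodule.span_singleton_le_iff_mem _ _).mpr hxp))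
      rw [mem_sup_span_singleton_zmod_two]
      by_cases hgv : g v = 0
      · exact .inl ⟨hv, hgv⟩
      · refine .inr ⟨p.1.add_mem hv hxp, ?_⟩
        rw [SetLike.mem_coe, LinearMap.mem_ker, map_add, hgx, ZMod.eq_one_of_ne_zero_two hgv,
          CharTwo.add_self_eq_zero]
    obtain ⟨h1, h2, h3, h⟩ := Building.exists_isThreeEdgeGeodesic (L := L) (A := p) (B := q)
      (H := H) rfl hpq inf_le_right hxg hrank
    exact ⟨L, q, H, hL, hq, hH, h1, h2, h3, h⟩
  · let q : BuildingVertex n := ⟨p.1 ⊔ Submodule.span (ZMod 2) {x},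
      fun h => p.2.1 (le_bot_iff.mp (le_sup_left.trans h.le)), htop⟩
    obtain ⟨h1, h2, h3, γ, a, b, h⟩ := Building.exists_isThreeEdgeGeodesic (L := L) (A := q)
      (B := p) (H := H) rfl rfl hpg hxg hrank
    -- When `p ≤ H`, the vertex `p` is the neighbour of the hyperplane, so the geodesic is traversed
    -- backwards, from `H` to `L`.
    exact ⟨H, q, L, hH, hq, hL, h3.symm, h2.symm, h1.symm, _, _, _, h.reverse⟩

end
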